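/- **Theorem.** Let $(\mathsf M,\otimes,\mathbb 1)$ be a cocomplete symmetric monoidal category with a zero object (an object that is both initial and terminal) such that $X\otimes-$ and $-\otimes X$ preserve colimits for every object $X$, and suppose that every map of $\mathsf M$ has a kernel. Let $\overrightarrow{\mathsf M}$ be the category of arrows of $\mathsf M$ and commutative squares. Write $\overrightarrow{\mathsf M}{}^{\otimes}$ for $\overrightarrow{\mathsf M}$ with the entrywise tensor product of arrows (unit $\mathrm{Id}:\mathbb 1\to\mathbb 1$), and $\overrightarrow{\mathsf M}{}^{\square}$ for $\overrightarrow{\mathsf M}$ with the pushout product $$f\,\square\,g:\ (X_1\otimes Y_0)\amalg_{X_0\otimes Y_0}(X_0\otimes Y_1)\longrightarrow X_1\otimes Y_1\qquad (f:X_0\to X_1,\ g:Y_0\to Y_1)$$ (unit $\varnothing\to\mathbb 1$). Let $\mathrm{coker}:\overrightarrow{\mathsf M}{}^{\square}\to\overrightarrow{\mathsf M}{}^{\otimes}$ send $f:X\to Y$ to the canonical map $Y\to\mathrm{coker}\,f$, and let $\ker:\overrightarrow{\mathsf M}{}^{\otimes}\to\overrightarrow{\mathsf M}{}^{\square}$ send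 $g:A\to B$ to the canonical map $\ker g\to A$. These form Hovey's adjunction $\mathrm{coker}\dashv\ker$. Let $\mathfrak C$ be a set and let $\mathsf O$ be a $\mathfrak C$-colored (symmetric) operad in $\mathsf M$. Let $\mathsf O^{\otimes}$ be the colored operad in $\overrightarrow{\mathsf M}{}^{\otimes}$ obtained by applying $X\mapsto(\mathrm{Id}:X\to X)$ to the entries of $\mathsf O$, and let $\mathsf O^{\square}$ be the colored operad in $\overrightarrow{\mathsf M}{}^{\square}$ obtained by applying $X\mapsto(\varnothing\to X)$. A *Smith $\mathsf O$-ideal* is an $\mathsf O^{\square}$-algebra in $\overrightarrow{\mathsf M}{}^{\square}$; an *$\mathsf O$-algebra map* is (equivalently) an $\mathsf O^{\otimes}$-algebra in $\overrightarrow{\mathsf M}{}^{\otimes}$. The codomains of a Smith $\mathsf O$-ideal form an $\mathsf O$-algebra, and so do the domains of an $\mathsf O^{\otimes}$-algebra. Then there is an adjunction $$\mathrm{coker}:\ \mathsf{Alg}(\mathsf O^{\square};\overrightarrow{\mathsf M}{}^{\square})\ \rightleftarrows\ \mathsf{Alg}(\mathsf O^{\otimes};\overrightarrow{\mathsf M}{}^{\otimes})\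 :\ker ,$$ with $\mathrm{coker}$ on the left, that lifts Hovey's adjunction entrywise: on the underlying $\mathfrak C$-indexed families of arrows, the left adjoint is $\mathrm{coker}$, the right adjoint is $\ker$, and the unit and the counit are those of Hovey's adjunction, in each color. Moreover, for every Smith $\mathsf O$-ideal $(f_c:X_c\to Y_c)_{c}$ the $\mathsf O$-algebra structure on the domains of $(Y_c\to\mathrm{coker}\,f_c)_c$ is the one on $Y$, and for every $\mathsf O^{\otimes}$-algebra $(g_c:A_c\to B_c)_c$ the $\mathsf O$-algebra structure on the codomains of $(\ker g_c\to A_c)_c$ is the one on $A$. -/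

import Mathlib

open CategoryTheory MonoidalCategory Limits

universe w w' v v' u u'

set_option linter.unusedSectionVars false

namespace SmithIdeals

section PermWords

/-- A word in adjacent transpositions that rearranges one list into another. Each word represents a
permutation (see `PermWord.toEquiv`), and every permutation is represented by some word; words are
used to write down the induced symmetry isomorphisms of iterated tensor products. -/
inductive PermWord {α : Type w} : List α → List α → Type w
  | nil : PermWord [] []
  | cons (a : α) {l l' : List α} (p : PermWord l l') : PermWord (a :: l) (a :: l')
  | swap (a b : α) (l : List α) : PermWord (a :: b :: l) (b :: a :: l)
  | trans {l l' l'' : List α} (p : PermWord l l') (q : PermWord l' l'') : PermWord l l''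

namespace PermWord

variable {α : Type w} {β : Type w'}

/-- The empty rearrangement. -/
def refl : (l : List α) → PermWord l l
  | [] => nil
  | a :: l => cons a (refl l)

def map (f : α → β) : {l l' : List α} → PermWord l l' → PermWord (l.map f) (l'.map f)
  | _, _, nil => nil
  | _, _, cons a p => cons (f a) (map f p)
  | _, _, swap a b l => swap (f a) (f b) (l.map f)
  | _, _, trans p q => trans (map f p) (map f q)

/-- The rearrangement `id ⊕ p`. -/
def appendLeft : (a : List α) → {l l' : List α} → PermWord l l' → PermWord (a ++ l) (a ++ l')
  | [], _, _, p => p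
  | x :: a, _, _, p => cons x (appendLeft a p)

/-- The rearrangement `p ⊕ id`. -/
def appendRight (r : List α) :
    {l l' : List α} → PermWord l l' → PermWord (l ++ r) (l' ++ r)
  | _, _, nil => refl r
  | _, _, cons a p => cons a (appendRight r p)
  | _, _, swap a b l => swap a b (l ++ r)
  | _, _, trans p q => trans (appendRight r p) (appendRight r q)

/-- Move one letter past a block. -/
def shift (x : α) : (b r : List α) → PermWord (x :: (b ++ r)) (b ++ x :: r)
  | [], r => refl (x :: r)
  | y :: b, r => trans (swap x y (b ++ r)) (cons y (shift x b r))

/-- Interchange two adjacent blocks. -/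
def blockSwap : (a b r : List α) → PermWord (a ++ (b ++ r)) (b ++ (a ++ r))
  | [], b, r => refl (b ++ r)
  | x :: a, b, r => trans (cons x (blockSwap a b r)) (shift x b (a ++ r))

/-- The block permutation induced by `p` when each letter `i` is replaced by the block `b i`. -/
def block (b : α → List β) :
    {l l' : List α} → PermWord l l' → PermWord (l.flatMap b) (l'.flatMap b)
  | _, _, nil => nil
  | _, _, cons a p => appendLeft (b a) (block b p)
  | _, _, swap x y l => blockSwap (b x) (b y) (l.flatMap b)
  | _, _, trans p q => trans (block b p) (block b q)

/-- The block sum of rearrangements of the blocks `b i`. -/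
def blockSum {b b' : α → List β} (p : ∀ i, PermWord (b i) (b' i)) :
    (l : List α) → PermWord (l.flatMap b) (l.flatMap b')
  | [] => nil
  | i :: l => trans (appendRight (l.flatMap b) (p i)) (appendLeft (b' i) (blockSum p l))

/-- The bijection of positions represented by a word. -/
def toEquiv : {l l' : List α} → PermWord l l' → (Fin l.length ≃ Fin l'.length)
  | _, _, nil => Equiv.refl _
  | _, _, cons _ (l := l) (l' := l') p =>
      (finSuccEquiv l.length).trans
        ((Equiv.optionCongr (toEquiv p)).trans (finSuccEquiv l'.length).symm)
  | _, _, swap _ _ l => Equiv.swap (0 : Fin (l.length + 2)) 1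
  | _, _, trans p q => (toEquiv p).trans (toEquiv q)

theorem get_toEquiv : {l l' : List α} → (p : PermWord l l') → (i : Fin l.length) →
    l'.get (p.toEquiv i) = l.get i
  | _, _, nil, i => i.elim0
  | _, _, cons a p, i => by
      refine Fin.cases ?_ (fun j => ?_) i
      · simp [toEquiv]
      · simpa [toEquiv] using get_toEquiv p j
  | _, _, swap a b l, i => by
      refine Fin.cases ?_ (fun j => Fin.cases ?_ (fun k => ?_) j) i
      · simp only [toEquiv]
        erw [Equiv.swap_apply_left]; rfl
      · simp only [toEquiv]
        erw [Equiv.swap_apply_right]; rfl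
      · simp only [toEquiv]
        erw [Equiv.swap_apply_of_ne_of_ne (Fin.succ_ne_zero _) (by
          intro h; exact Fin.succ_ne_zero k (Fin.succ_injective _ h))]
        rfl
  | _, _, trans p q, i => by
      simpa [toEquiv] using (get_toEquiv q (p.toEquiv i)).trans (get_toEquiv p i)

end PermWord
end PermWords

section Profiles

/-- A profile: a finite list of colors. Morphisms of profiles are the bijections of positions that
preserve colors. -/
structure Profile (C : Type w) where
  colors : List C

@[ext]
structure Profile.Hom {C : Type w} (c c' : Profile C) where
  equiv : Fin c.colors.length ≃ Fin c'.colors.length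
  get_equiv : ∀ i, c'.colors.get (equiv i) = c.colors.get i

instance (C : Type w) : Category.{0} (Profile C) where
  Hom := Profile.Hom
  id c := ⟨Equiv.refl _, fun _ => rfl⟩
  comp p q := ⟨p.equiv.trans q.equiv, fun i => (q.get_equiv _).trans (p.get_equiv i)⟩

/-- The morphism of profiles represented by a word. -/
def PermWord.toHom {C : Type w} {c c' : List C} (p : PermWord c c') :
    Profile.mk c ⟶ Profile.mk c' :=
  ⟨p.toEquiv, p.get_toEquiv⟩

end Profiles

section Tens

variable {V : Type u} [Category.{v} V] [MonoidalCategory V] {ι : Type w} {κ : Type w'}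

/-- The iterated tensor product `X i₁ ⊗ (X i₂ ⊗ (⋯ ⊗ 𝟙))` over a list of indices. -/
def tens (X : ι → V) : List ι → V
  | [] => 𝟙_ V
  | i :: l => X i ⊗ tens X l

/-- The tensor product of a family of maps. -/
def tensMap {X Y : ι → V} (f : ∀ i, X i ⟶ Y i) : (l : List ι) → (tens X l ⟶ tens Y l)
  | [] => 𝟙 (𝟙_ V)
  | i :: l => f i ⊗ₘ tensMap f l

theorem tensMap_id (X : ι → V) : ∀ l : List ι,
    tensMap (fun i => 𝟙 (X i)) l = 𝟙 (tens X l)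
  | [] => rfl
  | i :: l => by
      show 𝟙 (X i) ⊗ₘ tensMap (fun i => 𝟙 (X i)) l = 𝟙 (X i ⊗ tens X l)
      rw [tensMap_id X l, id_tensorHom_id]

theorem tensMap_comp {X Y Z : ι → V} (f : ∀ i, X i ⟶ Y i) (g : ∀ i, Y i ⟶ Z i) :
    ∀ l : List ι, tensMap (fun i => f i ≫ g i) l = tensMap f l ≫ tensMap g l
  | [] => (Category.id_comp _).symm
  | i :: l => by
      show (f i ≫ g i) ⊗ₘ tensMap (fun i => f i ≫ g i) l =
        (f i ⊗ₘ tensMap f l) ≫ (g i ⊗ₘ tensMap g l)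
      rw [tensMap_comp f g l, tensorHom_comp_tensorHom]

/-- The identification of iterated tensor products along a relabelling of the indices. -/
def tensReindex (f : κ → ι) (X : ι → V) :
    (l : List κ) → (tens (fun k => X (f k)) l ⟶ tens X (l.map f))
  | [] => 𝟙 (𝟙_ V)
  | k :: l => X (f k) ◁ tensReindex f X l

/-- Concatenation of iterated tensor products. -/
def tensAppend (X : ι → V) :
    (l l' : List ι) → (tens X l ⊗ tens X l' ⟶ tens X (l ++ l'))
  | [], l' => (λ_ (tens X l')).hom
  | i :: l, l' => (α_ (X i) (tens X l) (tens X l')).hom ≫ X i ◁ tensAppend X l l'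

/-- Removal of brackets from an iterated tensor product of iterated tensor products. -/
def tensFlatten (X : ι → V) (b : κ → List ι) :
    (l : List κ) → (tens (fun k => tens X (b k)) l ⟶ tens X (l.flatMap b))
  | [] => 𝟙 (𝟙_ V)
  | k :: l => tens X (b k) ◁ tensFlatten X b l ≫ tensAppend X (b k) (l.flatMap b)

/-- The iterated tensor product of copies of the unit is the unit. -/
def tensUnit : (l : List ι) → (tens (fun _ : ι => 𝟙_ V) l ⟶ 𝟙_ V)
  | [] => 𝟙 (𝟙_ V)
  | _ :: l => (λ_ _).hom ≫ tensUnit l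

variable [BraidedCategory V]

/-- The symmetry isomorphism `⨂ (X i ⊗ Y i) ⟶ (⨂ X i) ⊗ (⨂ Y i)`. -/
def tensShuffle (X Y : ι → V) :
    (l : List ι) → (tens (fun i => X i ⊗ Y i) l ⟶ tens X l ⊗ tens Y l)
  | [] => (λ_ (𝟙_ V)).inv
  | i :: l => (X i ⊗ Y i) ◁ tensShuffle X Y l ≫ tensorμ (X i) (Y i) (tens X l) (tens Y l)

/-- The symmetry isomorphism of iterated tensor products induced by a permutation. -/
def tensPerm (X : ι → V) : {l l' : List ι} → PermWord l l' → (tens X l ⟶ tens X l')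
  | _, _, .nil => 𝟙 (𝟙_ V)
  | _, _, .cons a p => X a ◁ tensPerm X p
  | _, _, .swap a b l =>
      (α_ (X a) (X b) (tens X l)).inv ≫ (β_ (X a) (X b)).hom ▷ tens X l ≫
        (α_ (X b) (X a) (tens X l)).hom
  | _, _, .trans p q => tensPerm X p ≫ tensPerm X q

end Tens

section Operads

open Opposite

/-- A `C`-colored symmetric sequence: for each output color `d`, a contravariant functor on the
groupoid of profiles, i.e. objects `S (c₁, …, cₙ; d)` with right actions of permutations. -/
abbrev SymSeq (C : Type w) (V : Type u) [Category.{v} V] := C → (Profile C)ᵒᵖ ⥤ V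

namespace SymSeq

variable {C : Type w} {V : Type u} [Category.{v} V]

/-- The entry `S (c; d)`. -/
def entry (S : SymSeq C V) (c : List C) (d : C) : V := (S d).obj (op ⟨c⟩)

/-- The right action of a permutation on the entries of a symmetric sequence. -/
def act (S : SymSeq C V) {c c' : List C} (p : PermWord c c') (d : C) :
    S.entry c' d ⟶ S.entry c d :=
  (S d).map p.toHom.op

/-- Transport of entries along an equality of profiles. -/
def cast (S : SymSeq C V) {c c' : List C} (h : c = c') (d : C) : S.entry c d ⟶ S.entry c' d :=
  eqToHom (congrArg (fun x => S.entry x d) h)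

end SymSeq

/-- The data of a `C`-colored operad: a symmetric sequence, the operadic compositions
`O (c₁, …, cₙ; d) ⊗ ⨂ᵢ O (bᵢ; cᵢ) ⟶ O (b₁ ⋯ bₙ; d)`, where the pairs `(bᵢ, cᵢ)` are listed in `L`,
and the units `𝟙 ⟶ O (c; c)`. -/
structure OperadData (C : Type w) (V : Type u) [Category.{v} V] [MonoidalCategory V] where
  seq : SymSeq C V
  gamma : ∀ (L : List (List C × C)) (d : C),
    seq.entry (L.map Prod.snd) d ⊗ tens (fun q : List C × C => seq.entry q.1 q.2) L ⟶
      seq.entry (L.flatMap Prod.fst) d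
  one : ∀ c : C, 𝟙_ V ⟶ seq.entry [c] c

namespace OperadData

variable {C : Type w} {V : Type u} [Category.{v} V] [MonoidalCategory V]

/-- Operadic composition for the pairs `(b i, c i)` with `i` running through the list `l`. -/
def gammaFamily (O : OperadData C V) {ι : Type w'} (l : List ι) (b : ι → List C) (c : ι → C)
    (d : C) :
    O.seq.entry (l.map c) d ⊗ tens (fun i => O.seq.entry (b i) (c i)) l ⟶
      O.seq.entry (l.flatMap b) d :=
  (O.seq.cast (by simp [Function.comp_def]) d ⊗ₘ
      tensReindex (fun i => (b i, c i)) (fun q : List C × C => O.seq.entry q.1 q.2) l) ≫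
    O.gamma (l.map fun i => (b i, c i)) d ≫ O.seq.cast (by simp [List.flatMap_map]) d

end OperadData

/-- A `C`-colored (symmetric) operad in a symmetric monoidal category: operadic composition is
associative, left and right unital, and equivariant with respect to permutations of the inputs of
the outer operation (`gamma_outer`) and of the inner operations (`gamma_inner`). -/
structure ColoredOperad (C : Type w) (V : Type u) [Category.{v} V] [MonoidalCategory V]
    [SymmetricCategory V] extends OperadData C V where
  gamma_assoc : ∀ (L : List (List (List C × C) × C)) (d : C),
    seq.entry (L.map Prod.snd) d ◁ tensMap (fun p => gamma p.1 p.2) L ≫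
        toOperadData.gammaFamily L (fun p => p.1.flatMap Prod.fst) Prod.snd d =
      seq.entry (L.map Prod.snd) d ◁
          tensShuffle (fun p => seq.entry (p.1.map Prod.snd) p.2)
            (fun p => tens (fun q : List C × C => seq.entry q.1 q.2) p.1) L ≫
        (α_ _ _ _).inv ≫
        (toOperadData.gammaFamily L (fun p => p.1.map Prod.snd) Prod.snd d ⊗ₘ
          tensFlatten (fun q : List C × C => seq.entry q.1 q.2) Prod.fst L) ≫
        seq.cast List.map_flatMap.symm d ▷ _ ≫
        gamma (L.flatMap Prod.fst) d ≫
        seq.cast List.flatMap_assoc d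
  one_gamma : ∀ (c : List C) (d : C),
    one d ▷ (seq.entry c d ⊗ 𝟙_ V) ≫ gamma [(c, d)] d ≫ seq.cast (by simp) d =
      (λ_ (seq.entry c d ⊗ 𝟙_ V)).hom ≫ (ρ_ (seq.entry c d)).hom
  gamma_one : ∀ (c : List C) (d : C),
    seq.entry c d ◁ tensMap (fun x : C => one x) c ≫ seq.cast (List.map_id' c).symm d ▷ _ ≫
        toOperadData.gammaFamily c (fun x => [x]) (fun x => x) d ≫ seq.cast (by simp) d =
      seq.entry c d ◁ tensUnit c ≫ (ρ_ (seq.entry c d)).hom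
  gamma_outer : ∀ {L L' : List (List C × C)} (p : PermWord L L') (d : C),
    seq.act (p.map Prod.snd) d ▷ tens (fun q : List C × C => seq.entry q.1 q.2) L ≫ gamma L d =
      seq.entry (L'.map Prod.snd) d ◁ tensPerm (fun q : List C × C => seq.entry q.1 q.2) p ≫
        gamma L' d ≫ seq.act (p.block Prod.fst) d
  gamma_inner : ∀ {ι : Type} (l : List ι) (b b' : ι → List C) (c : ι → C)
    (p : ∀ i, PermWord (b i) (b' i)) (d : C),
    seq.entry (l.map c) d ◁ tensMap (fun i => seq.act (p i) (c i)) l ≫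
        toOperadData.gammaFamily l b c d =
      toOperadData.gammaFamily l b' c d ≫ seq.act (PermWord.blockSum p l) d

namespace ColoredOperad

variable {C : Type w} {V : Type u} [Category.{v} V] [MonoidalCategory V] [SymmetricCategory V]

abbrev entry (O : ColoredOperad C V) (c : List C) (d : C) : V := O.seq.entry c d

/-- An algebra over a colored operad: a family of objects `X c` with structure maps
`O (c₁, …, cₙ; d) ⊗ X c₁ ⊗ ⋯ ⊗ X cₙ ⟶ X d` that are associative, unital and equivariant. -/
structure Algebra (O : ColoredOperad C V) where
  obj : C → V
  act : ∀ (c : List C) (d : C), O.entry c d ⊗ tens obj c ⟶ obj d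
  assoc : ∀ (L : List (List C × C)) (d : C),
    O.entry (L.map Prod.snd) d ◁ tensMap (fun q : List C × C => act q.1 q.2) L ≫
        O.entry (L.map Prod.snd) d ◁ tensReindex Prod.snd obj L ≫ act (L.map Prod.snd) d =
      O.entry (L.map Prod.snd) d ◁
          tensShuffle (fun q : List C × C => O.entry q.1 q.2) (fun q => tens obj q.1) L ≫
        (α_ _ _ _).inv ≫
        (O.gamma L d ⊗ₘ tensFlatten obj Prod.fst L) ≫
        act (L.flatMap Prod.fst) d
  unit : ∀ c : C, O.one c ▷ (obj c ⊗ 𝟙_ V) ≫ act [c] c = (λ_ _).hom ≫ (ρ_ (obj c)).hom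
  equivariant : ∀ {c c' : List C} (p : PermWord c c') (d : C),
    O.seq.act p d ▷ tens obj c ≫ act c d = O.entry c' d ◁ tensPerm obj p ≫ act c' d

namespace Algebra

variable {O : ColoredOperad C V}

/-- A morphism of algebras: a family of maps compatible with the structure maps. -/
@[ext]
structure Hom (A B : O.Algebra) where
  hom : ∀ c, A.obj c ⟶ B.obj c
  act_hom : ∀ (c : List C) (d : C),
    A.act c d ≫ hom d = O.entry c d ◁ tensMap hom c ≫ B.act c d

instance : Category (O.Algebra) where
  Hom := Hom
  id A := ⟨fun c => 𝟙 (A.obj c), fun c d => by rw [tensMap_id]; simp⟩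
  comp f g := ⟨fun c => f.hom c ≫ g.hom c, fun c d => by
    rw [tensMap_comp, MonoidalCategory.whiskerLeft_comp, Category.assoc, ← g.act_hom,
      ← Category.assoc, f.act_hom, Category.assoc]⟩

/-- The forgetful functor to `C`-indexed families of objects. -/
def forget (O : ColoredOperad C V) : O.Algebra ⥤ (C → V) where
  obj A := A.obj
  map f := f.hom

end Algebra
end ColoredOperad
end Operads

section LaxTens

variable {V : Type u} [Category.{v} V] [MonoidalCategory V]
  {W : Type u'} [Category.{v'} W] [MonoidalCategory W]
  (F : V ⥤ W) [F.LaxMonoidal] {ι : Type w} {κ : Type w'}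

open Functor.LaxMonoidal

/-- The comparison map `⨂ F (X i) ⟶ F (⨂ X i)` of a lax monoidal functor. -/
def tensLax (X : ι → V) : (l : List ι) → (tens (fun i => F.obj (X i)) l ⟶ F.obj (tens X l))
  | [] => ε F
  | i :: l => F.obj (X i) ◁ tensLax X l ≫ μ F (X i) (tens X l)

theorem tensLax_map {X Y : ι → V} (f : ∀ i, X i ⟶ Y i) : ∀ l : List ι,
    tensMap (fun i => F.map (f i)) l ≫ tensLax F Y l = tensLax F X l ≫ F.map (tensMap f l)
  | [] => by
      show 𝟙 (𝟙_ W) ≫ ε F = ε F ≫ F.map (𝟙 (𝟙_ V))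
      simp
  | i :: l => by
      show (F.map (f i) ⊗ₘ tensMap (fun i => F.map (f i)) l) ≫
          F.obj (Y i) ◁ tensLax F Y l ≫ μ F (Y i) (tens Y l) =
        (F.obj (X i) ◁ tensLax F X l ≫ μ F (X i) (tens X l)) ≫ F.map (f i ⊗ₘ tensMap f l)
      rw [Category.assoc, ← μ_natural, MonoidalCategory.tensorHom_def, Category.assoc,
        ← MonoidalCategory.whiskerLeft_comp_assoc, tensLax_map f l, MonoidalCategory.tensorHom_def,
        MonoidalCategory.whiskerLeft_comp, Category.assoc, Category.assoc,
        ← whisker_exchange_assoc]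

theorem tensLax_reindex (f : κ → ι) (X : ι → V) : ∀ l : List κ,
    tensReindex f (fun i => F.obj (X i)) l ≫ tensLax F X (l.map f) =
      tensLax F (fun k => X (f k)) l ≫ F.map (tensReindex f X l)
  | [] => by
      show 𝟙 (𝟙_ W) ≫ ε F = ε F ≫ F.map (𝟙 (𝟙_ V))
      simp
  | k :: l => by
      show F.obj (X (f k)) ◁ tensReindex f (fun i => F.obj (X i)) l ≫
          F.obj (X (f k)) ◁ tensLax F X (l.map f) ≫ μ F (X (f k)) (tens X (l.map f)) =
        (F.obj (X (f k)) ◁ tensLax F (fun k => X (f k)) l ≫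
          μ F (X (f k)) (tens (fun k => X (f k)) l)) ≫ F.map (X (f k) ◁ tensReindex f X l)
      rw [← MonoidalCategory.whiskerLeft_comp_assoc, tensLax_reindex f X l, Category.assoc,
        ← μ_natural_right, MonoidalCategory.whiskerLeft_comp_assoc]

theorem tensLax_append (X : ι → V) : ∀ l l' : List ι,
    tensAppend (fun i => F.obj (X i)) l l' ≫ tensLax F X (l ++ l') =
      (tensLax F X l ⊗ₘ tensLax F X l') ≫ μ F _ _ ≫ F.map (tensAppend X l l')
  | [], l' => by
      show (λ_ (tens (fun i => F.obj (X i)) l')).hom ≫ tensLax F X l' =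
        (ε F ⊗ₘ tensLax F X l') ≫ μ F (𝟙_ V) (tens X l') ≫ F.map (λ_ (tens X l')).hom
      rw [ε_tensorHom_comp_μ_assoc, ← F.map_comp, Iso.inv_hom_id, F.map_id, Category.comp_id,
        leftUnitor_naturality]
  | i :: l, l' => by
      show ((α_ (F.obj (X i)) (tens (fun i => F.obj (X i)) l)
          (tens (fun i => F.obj (X i)) l')).hom ≫
          F.obj (X i) ◁ tensAppend (fun i => F.obj (X i)) l l') ≫
          F.obj (X i) ◁ tensLax F X (l ++ l') ≫ μ F (X i) (tens X (l ++ l')) =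
        ((F.obj (X i) ◁ tensLax F X l ≫ μ F (X i) (tens X l)) ⊗ₘ tensLax F X l') ≫
          μ F (X i ⊗ tens X l) (tens X l') ≫
          F.map ((α_ (X i) (tens X l) (tens X l')).hom ≫ X i ◁ tensAppend X l l')
      rw [Category.assoc, ← MonoidalCategory.whiskerLeft_comp_assoc, tensLax_append X l l',
        F.map_comp, MonoidalCategory.whiskerLeft_comp, MonoidalCategory.whiskerLeft_comp,
        Category.assoc, Category.assoc, μ_natural_right]
      have h : ((F.obj (X i) ◁ tensLax F X l ≫ μ F (X i) (tens X l)) ⊗ₘ tensLax F X l') =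
          (F.obj (X i) ◁ tensLax F X l ⊗ₘ tensLax F X l') ≫
            μ F (X i) (tens X l) ▷ F.obj (tens X l') := by
        rw [← tensorHom_id, tensorHom_comp_tensorHom, Category.comp_id]
      rw [h, Category.assoc, associativity_assoc, ← id_tensorHom, ← id_tensorHom (F.obj (X i))
        (tensLax F X l), associator_naturality_assoc]

theorem tensLax_flatten (X : ι → V) (b : κ → List ι) : ∀ l : List κ,
    tensFlatten (fun i => F.obj (X i)) b l ≫ tensLax F X (l.flatMap b) =
      tensMap (fun k => tensLax F X (b k)) l ≫ tensLax F (fun k => tens X (b k)) l ≫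
        F.map (tensFlatten X b l)
  | [] => by
      show 𝟙 (𝟙_ W) ≫ ε F = 𝟙 (𝟙_ W) ≫ ε F ≫ F.map (𝟙 (𝟙_ V))
      simp
  | k :: l => by
      show (tens (fun i => F.obj (X i)) (b k) ◁ tensFlatten (fun i => F.obj (X i)) b l ≫
          tensAppend (fun i => F.obj (X i)) (b k) (l.flatMap b)) ≫
          tensLax F X (b k ++ l.flatMap b) =
        (tensLax F X (b k) ⊗ₘ tensMap (fun k => tensLax F X (b k)) l) ≫
          (F.obj (tens X (b k)) ◁ tensLax F (fun k => tens X (b k)) l ≫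
            μ F (tens X (b k)) (tens (fun k => tens X (b k)) l)) ≫
          F.map (tens X (b k) ◁ tensFlatten X b l ≫ tensAppend X (b k) (l.flatMap b))
      rw [Category.assoc, tensLax_append, F.map_comp, Category.assoc, ← μ_natural_right_assoc,
        ← id_tensorHom, ← id_tensorHom, ← id_tensorHom, tensorHom_comp_tensorHom_assoc,
        tensorHom_comp_tensorHom_assoc, tensorHom_comp_tensorHom_assoc, tensLax_flatten X b l]
      simp only [Category.id_comp, Category.comp_id, Category.assoc]

theorem tensLax_unit : ∀ l : List ι,
    tensMap (fun _ => ε F) l ≫ tensLax F (fun _ : ι => 𝟙_ V) l ≫ F.map (tensUnit l) =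
      tensUnit l ≫ ε F
  | [] => by
      show 𝟙 (𝟙_ W) ≫ ε F ≫ F.map (𝟙 (𝟙_ V)) = 𝟙 (𝟙_ W) ≫ ε F
      simp
  | i :: l => by
      show (ε F ⊗ₘ tensMap (fun _ => ε F) l) ≫
          (F.obj (𝟙_ V) ◁ tensLax F (fun _ : ι => 𝟙_ V) l ≫ μ F (𝟙_ V) (tens (fun _ => 𝟙_ V) l)) ≫
          F.map ((λ_ _).hom ≫ tensUnit l) = ((λ_ _).hom ≫ tensUnit l) ≫ ε F
      rw [Category.assoc (λ_ _).hom, ← tensLax_unit l, ← leftUnitor_naturality_assoc,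
        leftUnitor_naturality_assoc, F.map_comp, Category.assoc, ← id_tensorHom,
        tensorHom_comp_tensorHom_assoc, Category.comp_id, ε_tensorHom_comp_μ_assoc,
        ← F.map_comp_assoc, Iso.inv_hom_id, F.map_id, Category.id_comp, leftUnitor_naturality_assoc,
        Category.assoc]
      

end LaxTens

section LaxTensBraided

variable {V : Type u} [Category.{v} V] [MonoidalCategory V] [BraidedCategory V]
  {W : Type u'} [Category.{v'} W] [MonoidalCategory W] [BraidedCategory W]
  (F : V ⥤ W) [F.LaxBraided] {ι : Type w} {κ : Type w'}

open Functor.LaxMonoidal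

theorem tensLax_shuffle (X Y : ι → V) : ∀ l : List ι,
    tensMap (fun i => μ F (X i) (Y i)) l ≫ tensLax F (fun i => X i ⊗ Y i) l ≫
        F.map (tensShuffle X Y l) =
      tensShuffle (fun i => F.obj (X i)) (fun i => F.obj (Y i)) l ≫
        (tensLax F X l ⊗ₘ tensLax F Y l) ≫ μ F (tens X l) (tens Y l)
  | [] => by
      show 𝟙 (𝟙_ W) ≫ ε F ≫ F.map (λ_ (𝟙_ V)).inv =
        (λ_ (𝟙_ W)).inv ≫ (ε F ⊗ₘ ε F) ≫ μ F (𝟙_ V) (𝟙_ V)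
      rw [ε_tensorHom_comp_μ, leftUnitor_naturality_assoc, Iso.inv_hom_id_assoc, Category.id_comp]
  | i :: l => by
      show (μ F (X i) (Y i) ⊗ₘ tensMap (fun i => μ F (X i) (Y i)) l) ≫
          (F.obj (X i ⊗ Y i) ◁ tensLax F (fun i => X i ⊗ Y i) l ≫
            μ F (X i ⊗ Y i) (tens (fun i => X i ⊗ Y i) l)) ≫
          F.map ((X i ⊗ Y i) ◁ tensShuffle X Y l ≫ tensorμ (X i) (Y i) (tens X l) (tens Y l)) =
        ((F.obj (X i) ⊗ F.obj (Y i)) ◁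
            tensShuffle (fun i => F.obj (X i)) (fun i => F.obj (Y i)) l ≫
          tensorμ (F.obj (X i)) (F.obj (Y i)) (tens (fun i => F.obj (X i)) l)
            (tens (fun i => F.obj (Y i)) l)) ≫
          ((F.obj (X i) ◁ tensLax F X l ≫ μ F (X i) (tens X l)) ⊗ₘ
            (F.obj (Y i) ◁ tensLax F Y l ≫ μ F (Y i) (tens Y l))) ≫
          μ F (X i ⊗ tens X l) (Y i ⊗ tens Y l)
      rw [← tensorHom_comp_tensorHom, Category.assoc, Category.assoc, Category.assoc,
        ← tensorμ_natural_right_assoc,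
        tensorμ_comp_μ_tensorHom_μ_comp_μ, ← MonoidalCategory.whiskerLeft_comp_assoc,
        F.map_comp, ← μ_natural_right_assoc]
      simp only [← id_tensorHom, tensorHom_comp_tensorHom_assoc, Category.id_comp,
        Category.comp_id, Category.assoc]
      rw [tensLax_shuffle X Y l]

theorem tensLax_perm (X : ι → V) : ∀ {l l' : List ι} (p : PermWord l l'),
    tensPerm (fun i => F.obj (X i)) p ≫ tensLax F X l' = tensLax F X l ≫ F.map (tensPerm X p)
  | _, _, .nil => by
      show 𝟙 (𝟙_ W) ≫ ε F = ε F ≫ F.map (𝟙 (𝟙_ V))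
      simp
  | _, _, .cons a p (l := l) (l' := l') => by
      show F.obj (X a) ◁ tensPerm (fun i => F.obj (X i)) p ≫
          F.obj (X a) ◁ tensLax F X l' ≫ μ F (X a) (tens X l') =
        (F.obj (X a) ◁ tensLax F X l ≫ μ F (X a) (tens X l)) ≫ F.map (X a ◁ tensPerm X p)
      rw [← MonoidalCategory.whiskerLeft_comp_assoc, tensLax_perm X p, Category.assoc,
        ← μ_natural_right, MonoidalCategory.whiskerLeft_comp_assoc]
  | _, _, .swap a b l => by
      show ((α_ (F.obj (X a)) (F.obj (X b)) (tens (fun i => F.obj (X i)) l)).inv ≫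
          (β_ (F.obj (X a)) (F.obj (X b))).hom ▷ tens (fun i => F.obj (X i)) l ≫
          (α_ (F.obj (X b)) (F.obj (X a)) (tens (fun i => F.obj (X i)) l)).hom) ≫
          F.obj (X b) ◁ (F.obj (X a) ◁ tensLax F X l ≫ μ F (X a) (tens X l)) ≫
            μ F (X b) (X a ⊗ tens X l) =
        (F.obj (X a) ◁ (F.obj (X b) ◁ tensLax F X l ≫ μ F (X b) (tens X l)) ≫
            μ F (X a) (X b ⊗ tens X l)) ≫
          F.map ((α_ (X a) (X b) (tens X l)).inv ≫ (β_ (X a) (X b)).hom ▷ tens X l ≫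
            (α_ (X b) (X a) (tens X l)).hom)
      simp only [MonoidalCategory.whiskerLeft_comp, Category.assoc, F.map_comp]
      rw [associativity_inv_assoc, ← μ_natural_left_assoc,
        ← comp_whiskerRight_assoc, Functor.LaxBraided.braided, comp_whiskerRight_assoc,
        associativity,
        ← associator_naturality_right_assoc, ← whisker_exchange_assoc,
        associator_inv_naturality_right_assoc]
  | _, _, .trans p q => by
      show (tensPerm (fun i => F.obj (X i)) p ≫ tensPerm (fun i => F.obj (X i)) q) ≫ _ =
        _ ≫ F.map (tensPerm X p ≫ tensPerm X q)
      rw [Category.assoc, tensLax_perm X q, ← Category.assoc, tensLax_perm X p, Category.assoc,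
        F.map_comp]

end LaxTensBraided

section ShuffleNat

variable {V : Type u} [Category.{v} V] [MonoidalCategory V] [BraidedCategory V] {ι : Type w}

theorem tensShuffle_natural {X Y X' Y' : ι → V} (f : ∀ i, X i ⟶ X' i) (g : ∀ i, Y i ⟶ Y' i) :
    ∀ l : List ι, tensMap (fun i => f i ⊗ₘ g i) l ≫ tensShuffle X' Y' l =
      tensShuffle X Y l ≫ (tensMap f l ⊗ₘ tensMap g l)
  | [] => by
      show 𝟙 (𝟙_ V) ≫ (λ_ (𝟙_ V)).inv = (λ_ (𝟙_ V)).inv ≫ (𝟙 (𝟙_ V) ⊗ₘ 𝟙 (𝟙_ V))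
      simp
  | i :: l => by
      show ((f i ⊗ₘ g i) ⊗ₘ tensMap (fun i => f i ⊗ₘ g i) l) ≫
          (X' i ⊗ Y' i) ◁ tensShuffle X' Y' l ≫ tensorμ (X' i) (Y' i) (tens X' l) (tens Y' l) =
        ((X i ⊗ Y i) ◁ tensShuffle X Y l ≫ tensorμ (X i) (Y i) (tens X l) (tens Y l)) ≫
          ((f i ⊗ₘ tensMap f l) ⊗ₘ (g i ⊗ₘ tensMap g l))
      rw [Category.assoc, ← tensorμ_natural, ← id_tensorHom, ← id_tensorHom,
        tensorHom_comp_tensorHom_assoc, tensorHom_comp_tensorHom_assoc,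
        tensShuffle_natural f g l, Category.id_comp, Category.comp_id]

end ShuffleNat

section OperadMap

open Functor.LaxMonoidal

variable {C : Type w} {V : Type u} [Category.{v} V] [MonoidalCategory V]
  {W : Type u'} [Category.{v'} W] [MonoidalCategory W]

namespace SymSeq

def map (F : V ⥤ W) (S : SymSeq C V) : SymSeq C W := fun d => S d ⋙ F

theorem map_cast (F : V ⥤ W) (S : SymSeq C V) {c c' : List C} (h : c = c') (d : C) :
    (S.map F).cast h d = F.map (S.cast h d) := by
  subst h
  exact (F.map_id _).symm

end SymSeq

theorem lax_reindex_aux (F : V ⥤ W) [F.LaxMonoidal] {Z Z' T T' U U' : V} {A B : W}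
    (c : Z ⟶ Z') (r : A ⟶ B) (a : A ⟶ F.obj U) (b : B ⟶ F.obj U') (s : U ⟶ U')
    (g : Z' ⊗ U' ⟶ T) (c' : T ⟶ T') (h : r ≫ b = a ≫ F.map s) :
    (F.map c ⊗ₘ r) ≫ (F.obj Z' ◁ b ≫ μ F Z' U' ≫ F.map g) ≫ F.map c' =
      F.obj Z ◁ a ≫ μ F Z U ≫ F.map ((c ⊗ₘ s) ≫ g ≫ c') := by
  rw [F.map_comp, F.map_comp, ← μ_natural_assoc]
  simp only [← id_tensorHom, tensorHom_comp_tensorHom_assoc, Category.id_comp,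
    Category.comp_id, Category.assoc]
  rw [h]

namespace OperadData

def map (F : V ⥤ W) [F.LaxMonoidal] (O : OperadData C V) : OperadData C W where
  seq := O.seq.map F
  gamma L d :=
    F.obj (O.seq.entry (L.map Prod.snd) d) ◁
        tensLax F (fun q : List C × C => O.seq.entry q.1 q.2) L ≫
      μ F _ _ ≫ F.map (O.gamma L d)
  one c := ε F ≫ F.map (O.one c)

theorem map_gammaFamily (F : V ⥤ W) [F.LaxMonoidal] (O : OperadData C V) {ι : Type w'}
    (l : List ι) (b : ι → List C) (c : ι → C) (d : C) :
    (O.map F).gammaFamily l b c d =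
      F.obj (O.seq.entry (l.map c) d) ◁ tensLax F (fun i => O.seq.entry (b i) (c i)) l ≫
        μ F _ _ ≫ F.map (O.gammaFamily l b c d) := by
  have h := tensLax_reindex F (fun i => (b i, c i)) (fun q : List C × C => O.seq.entry q.1 q.2) l
  show ((O.seq.map F).cast _ d ⊗ₘ
      tensReindex (fun i => (b i, c i)) (fun q : List C × C => F.obj (O.seq.entry q.1 q.2)) l) ≫
    (F.obj (O.seq.entry ((l.map fun i => (b i, c i)).map Prod.snd) d) ◁
        tensLax F (fun q : List C × C => O.seq.entry q.1 q.2) (l.map fun i => (b i, c i)) ≫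
      μ F _ _ ≫ F.map (O.gamma (l.map fun i => (b i, c i)) d)) ≫ (O.seq.map F).cast _ d = _
  rw [SymSeq.map_cast, SymSeq.map_cast]
  exact lax_reindex_aux F _ _ _ _ _ _ _ h

end OperadData

end OperadMap

section ColoredOperadMap

open Functor.LaxMonoidal

variable {C : Type w} {V : Type u} [Category.{v} V] [MonoidalCategory V] [SymmetricCategory V]
  {W : Type u'} [Category.{v'} W] [MonoidalCategory W] [SymmetricCategory W]

theorem lax_assoc_aux (F : V ⥤ W) [F.LaxBraided] {κ : Type w'} (L : List κ) {Z Z' T B' : V}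
    {A B D : κ → V} (g : ∀ k, A k ⊗ B k ⟶ D k) (gF : Z ⊗ tens D L ⟶ T)
    (G : Z ⊗ tens A L ⟶ Z') (fl : tens B L ⟶ B') (k : Z' ⊗ B' ⟶ T)
    (h : Z ◁ tensMap g L ≫ gF = Z ◁ tensShuffle A B L ≫ (α_ _ _ _).inv ≫ (G ⊗ₘ fl) ≫ k)
    {Bw : κ → W} {Bw' : W} (b : ∀ k, Bw k ⟶ F.obj (B k)) (b' : Bw' ⟶ F.obj B')
    (fl' : tens Bw L ⟶ Bw') (hfl : fl' ≫ b' = tensMap b L ≫ tensLax F B L ≫ F.map fl) :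
    F.obj Z ◁ tensMap (fun k => F.obj (A k) ◁ b k ≫ μ F (A k) (B k) ≫ F.map (g k)) L ≫
        (F.obj Z ◁ tensLax F D L ≫ μ F Z (tens D L) ≫ F.map gF) =
      F.obj Z ◁ tensShuffle (fun k => F.obj (A k)) Bw L ≫ (α_ _ _ _).inv ≫
        ((F.obj Z ◁ tensLax F A L ≫ μ F Z (tens A L) ≫ F.map G) ⊗ₘ fl') ≫
        (F.obj Z' ◁ b' ≫ μ F Z' B' ≫ F.map k) := by
  have h1 : tensMap (fun k => F.obj (A k) ◁ b k ≫ μ F (A k) (B k) ≫ F.map (g k)) L ≫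
      tensLax F D L =
      tensMap (fun k => 𝟙 (F.obj (A k)) ⊗ₘ b k) L ≫ tensMap (fun k => μ F (A k) (B k)) L ≫
        tensLax F (fun k => A k ⊗ B k) L ≫ F.map (tensMap g L) := by
    rw [← tensLax_map, ← reassoc_of% @tensMap_comp, ← reassoc_of% @tensMap_comp]
    simp only [id_tensorHom, Category.assoc]
  have h2 := tensShuffle_natural (fun k => 𝟙 (F.obj (A k))) b L
  rw [tensMap_id] at h2
  have h3 := tensLax_shuffle F A B L
  rw [← MonoidalCategory.whiskerLeft_comp_assoc, h1]
  simp only [MonoidalCategory.whiskerLeft_comp, Category.assoc]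
  rw [μ_natural_right_assoc, ← F.map_comp, h, F.map_comp, F.map_comp, F.map_comp,
    ← μ_natural_right_assoc]
  simp only [← MonoidalCategory.whiskerLeft_comp_assoc]
  rw [h3, reassoc_of% h2]
  simp only [MonoidalCategory.whiskerLeft_comp, Category.assoc]
  rw [associativity_inv_assoc, ← μ_natural_assoc,
    ← id_tensorHom (F.obj Z) (tensLax F A L ⊗ₘ tensLax F B L), associator_inv_naturality_assoc,
    ← id_tensorHom (F.obj Z) (𝟙 _ ⊗ₘ tensMap b L), associator_inv_naturality_assoc]
  simp only [← id_tensorHom, ← tensorHom_id, tensorHom_comp_tensorHom_assoc,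
    Category.id_comp, Category.comp_id, id_tensorHom_id]
  rw [hfl]

theorem lax_whiskerRight_aux (F : V ⥤ W) [F.LaxMonoidal] {Z Z' T U : V} {B : W}
    (c : Z ⟶ Z') (b : B ⟶ F.obj U) (g : Z' ⊗ U ⟶ T) :
    F.map c ▷ B ≫ (F.obj Z' ◁ b ≫ μ F Z' U ≫ F.map g) =
      F.obj Z ◁ b ≫ μ F Z U ≫ F.map (c ▷ U ≫ g) := by
  rw [F.map_comp, ← μ_natural_left_assoc, ← whisker_exchange_assoc]

theorem lax_whiskerLeft_aux (F : V ⥤ W) [F.LaxMonoidal] {Z T U U' : V} {B B' : W}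
    (x : B ⟶ B') (b : B ⟶ F.obj U) (b' : B' ⟶ F.obj U') (s : U ⟶ U') (g : Z ⊗ U' ⟶ T)
    (h : x ≫ b' = b ≫ F.map s) :
    F.obj Z ◁ x ≫ (F.obj Z ◁ b' ≫ μ F Z U' ≫ F.map g) =
      F.obj Z ◁ b ≫ μ F Z U ≫ F.map (Z ◁ s ≫ g) := by
  rw [F.map_comp, ← μ_natural_right_assoc, ← MonoidalCategory.whiskerLeft_comp_assoc, h,
    MonoidalCategory.whiskerLeft_comp_assoc]

theorem lax_comp_aux (F : V ⥤ W) [F.LaxMonoidal] {Z T T' U : V} {B : W}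
    (b : B ⟶ F.obj U) (g : Z ⊗ U ⟶ T) (c : T ⟶ T') :
    (F.obj Z ◁ b ≫ μ F Z U ≫ F.map g) ≫ F.map c =
      F.obj Z ◁ b ≫ μ F Z U ≫ F.map (g ≫ c) := by
  simp only [F.map_comp, Category.assoc]

theorem lax_leftUnit_aux (F : V ⥤ W) [F.LaxMonoidal] {Z U T : V} (e : 𝟙_ V ⟶ U)
    (g : U ⊗ Z ⊗ 𝟙_ V ⟶ T) (c : T ⟶ Z)
    (h : e ▷ (Z ⊗ 𝟙_ V) ≫ g ≫ c = (λ_ (Z ⊗ 𝟙_ V)).hom ≫ (ρ_ Z).hom) :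
    (ε F ≫ F.map e) ▷ (F.obj Z ⊗ 𝟙_ W) ≫
        (F.obj U ◁ (F.obj Z ◁ ε F ≫ μ F Z (𝟙_ V)) ≫ μ F U (Z ⊗ 𝟙_ V) ≫ F.map g) ≫ F.map c =
      (λ_ (F.obj Z ⊗ 𝟙_ W)).hom ≫ (ρ_ (F.obj Z)).hom := by
  rw [lax_comp_aux, comp_whiskerRight_assoc, lax_whiskerRight_aux, h, F.map_comp,
    ← whisker_exchange_assoc, ← left_unitality_assoc, leftUnitor_naturality_assoc,
    Category.assoc, ← right_unitality]

theorem lax_rightUnit_aux (F : V ⥤ W) [F.LaxMonoidal] {κ : Type w'} (L : List κ) {Z : V}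
    {X : κ → V} (f : ∀ k, 𝟙_ V ⟶ X k) (g : Z ⊗ tens X L ⟶ Z)
    (h : Z ◁ tensMap f L ≫ g = Z ◁ tensUnit L ≫ (ρ_ Z).hom) :
    F.obj Z ◁ tensMap (fun k => ε F ≫ F.map (f k)) L ≫
        (F.obj Z ◁ tensLax F X L ≫ μ F Z (tens X L) ≫ F.map g) =
      F.obj Z ◁ tensUnit L ≫ (ρ_ (F.obj Z)).hom := by
  rw [tensMap_comp, MonoidalCategory.whiskerLeft_comp_assoc,
    lax_whiskerLeft_aux F _ _ _ _ _ (tensLax_map F f L), h, F.map_comp, ← μ_natural_right_assoc,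
    ← MonoidalCategory.whiskerLeft_comp_assoc, ← MonoidalCategory.whiskerLeft_comp_assoc,
    Category.assoc, tensLax_unit, MonoidalCategory.whiskerLeft_comp_assoc, ← right_unitality]

namespace ColoredOperad

theorem map_gamma_assoc (F : V ⥤ W) [F.LaxBraided] (O : ColoredOperad C V)
    (L : List (List (List C × C) × C)) (d : C) :
    (O.seq.map F).entry (L.map Prod.snd) d ◁
        tensMap (fun p => (O.toOperadData.map F).gamma p.1 p.2) L ≫
        (O.toOperadData.map F).gammaFamily L (fun p => p.1.flatMap Prod.fst) Prod.snd d =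
      (O.seq.map F).entry (L.map Prod.snd) d ◁
          tensShuffle (fun p => (O.seq.map F).entry (p.1.map Prod.snd) p.2)
            (fun p => tens (fun q : List C × C => (O.seq.map F).entry q.1 q.2) p.1) L ≫
        (α_ _ _ _).inv ≫
        ((O.toOperadData.map F).gammaFamily L (fun p => p.1.map Prod.snd) Prod.snd d ⊗ₘ
          tensFlatten (fun q : List C × C => (O.seq.map F).entry q.1 q.2) Prod.fst L) ≫
        (O.seq.map F).cast List.map_flatMap.symm d ▷ _ ≫
        (O.toOperadData.map F).gamma (L.flatMap Prod.fst) d ≫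
        (O.seq.map F).cast List.flatMap_assoc d := by
  have key := lax_assoc_aux F L (fun p => O.gamma p.1 p.2)
    (O.toOperadData.gammaFamily L (fun p => p.1.flatMap Prod.fst) Prod.snd d)
    (O.toOperadData.gammaFamily L (fun p => p.1.map Prod.snd) Prod.snd d)
    (tensFlatten (fun q : List C × C => O.entry q.1 q.2) Prod.fst L) _ (O.gamma_assoc L d)
    (fun p => tensLax F (fun q : List C × C => O.entry q.1 q.2) p.1)
    (tensLax F (fun q : List C × C => O.entry q.1 q.2) (L.flatMap Prod.fst)) _
    (tensLax_flatten F _ Prod.fst L)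
  rw [OperadData.map_gammaFamily, OperadData.map_gammaFamily, SymSeq.map_cast, SymSeq.map_cast]
  refine key.trans ?_
  congr 3
  exact ((congrArg _ (lax_comp_aux F _ _ _)).trans (lax_whiskerRight_aux F _ _ _)).symm

/-- The image of a colored operad under a lax symmetric monoidal functor: every entry is sent
through the functor, and the structure maps are composed with those of the functor. -/
def map (F : V ⥤ W) [F.LaxBraided] (O : ColoredOperad C V) : ColoredOperad C W where
  toOperadData := O.toOperadData.map F
  gamma_assoc L d := map_gamma_assoc F O L d
  one_gamma c d := (congrArg (fun x => _ ≫ _ ≫ x) (SymSeq.map_cast F O.seq _ d)).trans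
    (lax_leftUnit_aux F (O.one d) (O.gamma [(c, d)] d) (O.seq.cast _ d) (O.one_gamma c d))
  gamma_one c d := by
    have h := lax_rightUnit_aux F c (fun x => O.one x) _ (O.gamma_one c d)
    refine Eq.trans ?_ h
    rw [OperadData.map_gammaFamily]
    refine congrArg (fun x => _ ≫ x) ?_
    refine Eq.trans ?_ (lax_whiskerRight_aux F _ _ _)
    refine congrArg₂ (fun x y => x ▷ _ ≫ y) (SymSeq.map_cast F O.seq _ d) ?_
    refine Eq.trans ?_ (lax_comp_aux F _ _ _)
    exact congrArg (fun x => _ ≫ x) (SymSeq.map_cast F O.seq _ d)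
  gamma_outer {L L'} p d := by
    refine (lax_whiskerRight_aux F (O.seq.act (p.map Prod.snd) d)
      (tensLax F (fun q : List C × C => O.entry q.1 q.2) L) (O.gamma L d)).trans ?_
    refine Eq.trans ?_ (congrArg (fun x => _ ≫ x) (lax_comp_aux F
      (tensLax F (fun q : List C × C => O.entry q.1 q.2) L') (O.gamma L' d)
      (O.seq.act (p.block Prod.fst) d))).symm
    rw [O.gamma_outer p d]
    exact (lax_whiskerLeft_aux F _ _ _ _ _
      (tensLax_perm F (fun q : List C × C => O.entry q.1 q.2) p)).symm
  gamma_inner l b b' c p d := by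
    rw [OperadData.map_gammaFamily, OperadData.map_gammaFamily]
    refine (lax_whiskerLeft_aux F (Z := O.entry (l.map c) d) _ _ _ _ (O.gammaFamily l b c d)
      (tensLax_map F (fun i => O.seq.act (p i) (c i)) l)).trans ?_
    rw [O.gamma_inner l b b' c p d]
    exact (lax_comp_aux F _ _ _).symm

end ColoredOperad

end ColoredOperadMap
section TensorArrow

variable {M : Type u} [Category.{v} M]

theorem arrow_hom_ext {f g : Arrow M} {h k : f ⟶ g} (h₁ : h.left = k.left)
    (h₂ : h.right = k.right) : h = k := Arrow.hom_ext h k h₁ h₂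

variable [MonoidalCategory M]

namespace TensorArrow

/-- The entrywise tensor product of arrows, with unit `𝟙 ⟶ 𝟙`. -/
@[reducible] def monoidalStruct : MonoidalCategoryStruct (Arrow M) where
  tensorObj f g := Arrow.mk (f.hom ⊗ₘ g.hom)
  whiskerLeft f g g' h := Arrow.homMk (f.left ◁ h.left) (f.right ◁ h.right) (by
    show f.left ◁ h.left ≫ (f.hom ⊗ₘ g'.hom) = (f.hom ⊗ₘ g.hom) ≫ f.right ◁ h.right
    rw [← id_tensorHom, ← id_tensorHom, tensorHom_comp_tensorHom, tensorHom_comp_tensorHom,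
      Arrow.w h, Category.id_comp, Category.comp_id])
  whiskerRight {f f'} h g := Arrow.homMk (h.left ▷ g.left) (h.right ▷ g.right) (by
    show h.left ▷ g.left ≫ (f'.hom ⊗ₘ g.hom) = (f.hom ⊗ₘ g.hom) ≫ h.right ▷ g.right
    rw [← tensorHom_id, ← tensorHom_id, tensorHom_comp_tensorHom, tensorHom_comp_tensorHom,
      Arrow.w h, Category.id_comp, Category.comp_id])
  tensorHom h k := Arrow.homMk (h.left ⊗ₘ k.left) (h.right ⊗ₘ k.right) (by simp)
  tensorUnit := Arrow.mk (𝟙 (𝟙_ M))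
  associator f g h := Arrow.isoMk (α_ f.left g.left h.left) (α_ f.right g.right h.right) (by simp)
  leftUnitor f := Arrow.isoMk (λ_ f.left) (λ_ f.right) (by simp)
  rightUnitor f := Arrow.isoMk (ρ_ f.left) (ρ_ f.right) (by simp)

/-- The monoidal structure on the arrow category given by the entrywise tensor product. -/
@[reducible] def monoidalCategory : MonoidalCategory (Arrow M) where
  __ := monoidalStruct
  tensorHom_def _ _ := arrow_hom_ext (tensorHom_def _ _) (tensorHom_def _ _)
  id_tensorHom_id _ _ := arrow_hom_ext (id_tensorHom_id _ _) (id_tensorHom_id _ _)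
  tensorHom_comp_tensorHom _ _ _ _ :=
    arrow_hom_ext (tensorHom_comp_tensorHom _ _ _ _) (tensorHom_comp_tensorHom _ _ _ _)
  whiskerLeft_id _ _ := arrow_hom_ext (whiskerLeft_id _ _) (whiskerLeft_id _ _)
  id_whiskerRight _ _ := arrow_hom_ext (id_whiskerRight _ _) (id_whiskerRight _ _)
  associator_naturality _ _ _ :=
    arrow_hom_ext (associator_naturality _ _ _) (associator_naturality _ _ _)
  leftUnitor_naturality _ := arrow_hom_ext (leftUnitor_naturality _) (leftUnitor_naturality _)
  rightUnitor_naturality _ := arrow_hom_ext (rightUnitor_naturality _) (rightUnitor_naturality _)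
  pentagon _ _ _ _ := arrow_hom_ext (pentagon _ _ _ _) (pentagon _ _ _ _)
  triangle _ _ := arrow_hom_ext (triangle _ _) (triangle _ _)

@[reducible] def symmetricCategory [SymmetricCategory M] :
    @SymmetricCategory (Arrow M) _ monoidalCategory :=
  letI : MonoidalCategory (Arrow M) := monoidalCategory
  { braiding := fun f g => Arrow.isoMk (β_ f.left g.left) (β_ f.right g.right)
      (BraidedCategory.braiding_naturality _ _).symm
    braiding_naturality_right := fun _ _ _ _ =>
      arrow_hom_ext (BraidedCategory.braiding_naturality_right _ _)
        (BraidedCategory.braiding_naturality_right _ _)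
    braiding_naturality_left := fun _ _ =>
      arrow_hom_ext (BraidedCategory.braiding_naturality_left _ _)
        (BraidedCategory.braiding_naturality_left _ _)
    hexagon_forward := fun _ _ _ =>
      arrow_hom_ext (BraidedCategory.hexagon_forward _ _ _)
        (BraidedCategory.hexagon_forward _ _ _)
    hexagon_reverse := fun _ _ _ =>
      arrow_hom_ext (BraidedCategory.hexagon_reverse _ _ _)
        (BraidedCategory.hexagon_reverse _ _ _)
    symmetry := fun _ _ =>
      arrow_hom_ext (SymmetricCategory.symmetry _ _) (SymmetricCategory.symmetry _ _) }

end TensorArrow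
end TensorArrow

section PushoutProductArrow

variable {M : Type u} [Category.{v} M] [MonoidalCategory M]

namespace PushoutProductArrow

section Corner

variable [HasPushouts M] {A B A' B' : M}

/-- The domain of the pushout product of `f : A ⟶ B` and `g : A' ⟶ B'`: the pushout of
`B ⊗ A'` and `A ⊗ B'` over `A ⊗ A'`. -/
noncomputable def corner (f : A ⟶ B) (g : A' ⟶ B') : M := pushout (f ▷ A') (A ◁ g)

noncomputable def inl (f : A ⟶ B) (g : A' ⟶ B') : B ⊗ A' ⟶ corner f g := pushout.inl _ _

noncomputable def inr (f : A ⟶ B) (g : A' ⟶ B') : A ⊗ B' ⟶ corner f g := pushout.inr _ _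

theorem condition (f : A ⟶ B) (g : A' ⟶ B') : f ▷ A' ≫ inl f g = A ◁ g ≫ inr f g :=
  pushout.condition

noncomputable def desc {f : A ⟶ B} {g : A' ⟶ B'} {Z : M} (a : B ⊗ A' ⟶ Z)
    (b : A ⊗ B' ⟶ Z) (h : f ▷ A' ≫ a = A ◁ g ≫ b) :
    corner f g ⟶ Z :=
  pushout.desc a b h

@[simp]
theorem inl_desc {f : A ⟶ B} {g : A' ⟶ B'} {Z : M} (a : B ⊗ A' ⟶ Z)
    (b : A ⊗ B' ⟶ Z) (h : f ▷ A' ≫ a = A ◁ g ≫ b) :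
    inl f g ≫ desc a b h = a :=
  pushout.inl_desc _ _ _

@[simp]
theorem inr_desc {f : A ⟶ B} {g : A' ⟶ B'} {Z : M} (a : B ⊗ A' ⟶ Z)
    (b : A ⊗ B' ⟶ Z) (h : f ▷ A' ≫ a = A ◁ g ≫ b) :
    inr f g ≫ desc a b h = b :=
  pushout.inr_desc _ _ _

theorem corner_hom_ext {f : A ⟶ B} {g : A' ⟶ B'} {Z : M} {a b : corner f g ⟶ Z}
    (h₁ : inl f g ≫ a = inl f g ≫ b) (h₂ : inr f g ≫ a = inr f g ≫ b) : a = b :=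
  pushout.hom_ext h₁ h₂

theorem isPushout (f : A ⟶ B) (g : A' ⟶ B') :
    IsPushout (f ▷ A') (A ◁ g) (inl f g) (inr f g) :=
  IsPushout.of_hasPushout _ _

/-- The pushout product of `f : A ⟶ B` and `g : A' ⟶ B'`, as a map to `B ⊗ B'`. -/
noncomputable def ppHom (f : A ⟶ B) (g : A' ⟶ B') : corner f g ⟶ B ⊗ B' :=
  desc (B ◁ g) (f ▷ B') (whisker_exchange _ _).symm

@[simp]
theorem inl_ppHom (f : A ⟶ B) (g : A' ⟶ B') : inl f g ≫ ppHom f g = B ◁ g := inl_desc _ _ _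

@[simp]
theorem inr_ppHom (f : A ⟶ B) (g : A' ⟶ B') : inr f g ≫ ppHom f g = f ▷ B' := inr_desc _ _ _

section Map

variable {C D C' D' : M} {f : A ⟶ B} {f₂ : C ⟶ D} {g : A' ⟶ B'} {g₂ : C' ⟶ D'}
  {a₀ : A ⟶ C} {a₁ : B ⟶ D} (ha : a₀ ≫ f₂ = f ≫ a₁)
  {b₀ : A' ⟶ C'} {b₁ : B' ⟶ D'} (hb : b₀ ≫ g₂ = g ≫ b₁)

/-- The map induced on domains of pushout products by two commutative squares. -/
noncomputable def mapCorner : corner f g ⟶ corner f₂ g₂ :=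
  desc ((a₁ ⊗ₘ b₀) ≫ inl f₂ g₂) ((a₀ ⊗ₘ b₁) ≫ inr f₂ g₂) (by
    rw [← tensorHom_id, ← id_tensorHom, tensorHom_comp_tensorHom_assoc,
      tensorHom_comp_tensorHom_assoc, Category.id_comp, Category.id_comp, ← ha, ← hb,
      show (a₀ ≫ f₂ ⊗ₘ b₀) = (a₀ ⊗ₘ b₀) ≫ f₂ ▷ C' by
        rw [← tensorHom_id, tensorHom_comp_tensorHom, Category.comp_id],
      show (a₀ ⊗ₘ b₀ ≫ g₂) = (a₀ ⊗ₘ b₀) ≫ C ◁ g₂ by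
        rw [← id_tensorHom, tensorHom_comp_tensorHom, Category.comp_id],
      Category.assoc, Category.assoc, condition])

@[simp]
theorem inl_mapCorner : inl f g ≫ mapCorner ha hb = (a₁ ⊗ₘ b₀) ≫ inl f₂ g₂ := inl_desc _ _ _

@[simp]
theorem inr_mapCorner : inr f g ≫ mapCorner ha hb = (a₀ ⊗ₘ b₁) ≫ inr f₂ g₂ := inr_desc _ _ _

theorem mapCorner_ppHom : mapCorner ha hb ≫ ppHom f₂ g₂ = ppHom f g ≫ (a₁ ⊗ₘ b₁) := by
  apply corner_hom_ext
  · rw [reassoc_of% @inl_mapCorner, inl_ppHom, reassoc_of% @inl_ppHom, ← id_tensorHom, ← id_tensorHom,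
      tensorHom_comp_tensorHom, tensorHom_comp_tensorHom, hb, Category.id_comp,
      Category.comp_id]
  · rw [reassoc_of% @inr_mapCorner, inr_ppHom, reassoc_of% @inr_ppHom, ← tensorHom_id, ← tensorHom_id,
      tensorHom_comp_tensorHom, tensorHom_comp_tensorHom, ha, Category.id_comp,
      Category.comp_id]

end Map

end Corner

section Assoc

variable {A B A' B' A'' B'' : M} [SymmetricCategory M] [HasFiniteColimits M] 
  [∀ W : M, PreservesFiniteColimits (tensorLeft W)]

theorem isPushout_left (W : M) (f : A ⟶ B) (g : A' ⟶ B') :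
    IsPushout (W ◁ f ▷ A') (W ◁ A ◁ g) (W ◁ inl f g) (W ◁ inr f g) :=
  (tensorLeft W).map_isPushout (isPushout f g)

theorem isPushout_right (f : A ⟶ B) (g : A' ⟶ B') (W : M) :
    IsPushout (f ▷ A' ▷ W) ((A ◁ g) ▷ W) (inl f g ▷ W) (inr f g ▷ W) :=
  (tensorRight W).map_isPushout (isPushout f g)

noncomputable def descL {W : M} {f : A ⟶ B} {g : A' ⟶ B'} {Z : M} (a : W ⊗ B ⊗ A' ⟶ Z)
    (b : W ⊗ A ⊗ B' ⟶ Z)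
    (h : W ◁ f ▷ A' ≫ a = W ◁ A ◁ g ≫ b) : W ⊗ corner f g ⟶ Z :=
  (isPushout_left W f g).desc a b h

noncomputable def descR {f : A ⟶ B} {g : A' ⟶ B'} {W : M} {Z : M} (a : (B ⊗ A') ⊗ W ⟶ Z)
    (b : (A ⊗ B') ⊗ W ⟶ Z)
    (h : f ▷ A' ▷ W ≫ a = (A ◁ g) ▷ W ≫ b) : corner f g ⊗ W ⟶ Z :=
  (isPushout_right f g W).desc a b h

@[simp]
theorem inl_descL {W : M} {f : A ⟶ B} {g : A' ⟶ B'} {Z : M} (a : W ⊗ B ⊗ A' ⟶ Z)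
    (b : W ⊗ A ⊗ B' ⟶ Z)
    (h : W ◁ f ▷ A' ≫ a = W ◁ A ◁ g ≫ b) :
    W ◁ inl f g ≫ descL a b h = a := (isPushout_left W f g).inl_desc a b h

@[simp]
theorem inr_descL {W : M} {f : A ⟶ B} {g : A' ⟶ B'} {Z : M} (a : W ⊗ B ⊗ A' ⟶ Z)
    (b : W ⊗ A ⊗ B' ⟶ Z)
    (h : W ◁ f ▷ A' ≫ a = W ◁ A ◁ g ≫ b) :
    W ◁ inr f g ≫ descL a b h = b := (isPushout_left W f g).inr_desc a b h

@[simp]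
theorem inl_descR {f : A ⟶ B} {g : A' ⟶ B'} {W : M} {Z : M} (a : (B ⊗ A') ⊗ W ⟶ Z)
    (b : (A ⊗ B') ⊗ W ⟶ Z)
    (h : f ▷ A' ▷ W ≫ a = (A ◁ g) ▷ W ≫ b) :
    inl f g ▷ W ≫ descR a b h = a := (isPushout_right f g W).inl_desc a b h

@[simp]
theorem inr_descR {f : A ⟶ B} {g : A' ⟶ B'} {W : M} {Z : M} (a : (B ⊗ A') ⊗ W ⟶ Z)
    (b : (A ⊗ B') ⊗ W ⟶ Z)
    (h : f ▷ A' ▷ W ≫ a = (A ◁ g) ▷ W ≫ b) :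
    inr f g ▷ W ≫ descR a b h = b := (isPushout_right f g W).inr_desc a b h

theorem left_hom_ext {W : M} {f : A ⟶ B} {g : A' ⟶ B'} {Z : M} {a b : W ⊗ corner f g ⟶ Z}
    (h₁ : W ◁ inl f g ≫ a = W ◁ inl f g ≫ b) (h₂ : W ◁ inr f g ≫ a = W ◁ inr f g ≫ b) :
    a = b := (isPushout_left W f g).hom_ext h₁ h₂

theorem right_hom_ext {f : A ⟶ B} {g : A' ⟶ B'} {W : M} {Z : M} {a b : corner f g ⊗ W ⟶ Z}
    (h₁ : inl f g ▷ W ≫ a = inl f g ▷ W ≫ b) (h₂ : inr f g ▷ W ≫ a = inr f g ▷ W ≫ b) :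
    a = b := (isPushout_right f g W).hom_ext h₁ h₂

section Left

variable (f : A ⟶ B) (g : A' ⟶ B') (h : A'' ⟶ B'')

noncomputable def i₁ : (B ⊗ B') ⊗ A'' ⟶ corner (ppHom f g) h := inl (ppHom f g) h

noncomputable def iR : corner f g ⊗ B'' ⟶ corner (ppHom f g) h := inr (ppHom f g) h

noncomputable def i₂ : (B ⊗ A') ⊗ B'' ⟶ corner (ppHom f g) h :=
  inl f g ▷ B'' ≫ iR f g h

noncomputable def i₃ : (A ⊗ B') ⊗ B'' ⟶ corner (ppHom f g) h :=
  inr f g ▷ B'' ≫ iR f g h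

theorem prod_condition : ppHom f g ▷ A'' ≫ i₁ f g h =
    corner f g ◁ h ≫ iR f g h := condition (ppHom f g) h

theorem i₁₂ : (B ◁ g) ▷ A'' ≫ i₁ f g h =
    (B ⊗ A') ◁ h ≫ i₂ f g h := by
  rw [← inl_ppHom f g, comp_whiskerRight_assoc, prod_condition, i₂, whisker_exchange_assoc]

theorem i₁₃ : (f ▷ B') ▷ A'' ≫ i₁ f g h =
    (A ⊗ B') ◁ h ≫ i₃ f g h := by
  rw [← inr_ppHom f g, comp_whiskerRight_assoc, prod_condition, i₃, whisker_exchange_assoc]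

theorem i₂₃ : (f ▷ A') ▷ B'' ≫ i₂ f g h =
    (A ◁ g) ▷ B'' ≫ i₃ f g h := by
  rw [i₂, i₃, ← comp_whiskerRight_assoc, condition, comp_whiskerRight_assoc]

variable {f g h}

theorem ext_iR {Z : M} {a b : corner (ppHom f g) h ⟶ Z} (h₁ : i₁ f g h ≫ a = i₁ f g h ≫ b)
    (h₂ : iR f g h ≫ a = iR f g h ≫ b) : a = b := corner_hom_ext h₁ h₂

theorem ext_i {Z : M} {a b : corner (ppHom f g) h ⟶ Z} (h₁ : i₁ f g h ≫ a = i₁ f g h ≫ b)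
    (h₂ : i₂ f g h ≫ a = i₂ f g h ≫ b) (h₃ : i₃ f g h ≫ a = i₃ f g h ≫ b) : a = b :=
  ext_iR h₁ (right_hom_ext (by simpa [i₂] using h₂) (by simpa [i₃] using h₃))

noncomputable def descI {Z : M} (a : (B ⊗ B') ⊗ A'' ⟶ Z)
    (b : (B ⊗ A') ⊗ B'' ⟶ Z) (c : (A ⊗ B') ⊗ B'' ⟶ Z)
    (h₁₂ : (B ◁ g) ▷ A'' ≫ a = (B ⊗ A') ◁ h ≫ b)
    (h₁₃ : (f ▷ B') ▷ A'' ≫ a = (A ⊗ B') ◁ h ≫ c)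
    (h₂₃ : (f ▷ A') ▷ B'' ≫ b = (A ◁ g) ▷ B'' ≫ c) :
    corner (ppHom f g) h ⟶ Z :=
  desc (f := ppHom f g) a (descR b c h₂₃) (by
    show ppHom f g ▷ A'' ≫ a = corner f g ◁ h ≫ descR b c h₂₃
    apply right_hom_ext
    · rw [← comp_whiskerRight_assoc, inl_ppHom, h₁₂, ← whisker_exchange_assoc, inl_descR]
    · rw [← comp_whiskerRight_assoc, inr_ppHom, h₁₃, ← whisker_exchange_assoc, inr_descR])

section

variable {Z : M} (a : (B ⊗ B') ⊗ A'' ⟶ Z)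
    (b : (B ⊗ A') ⊗ B'' ⟶ Z) (c : (A ⊗ B') ⊗ B'' ⟶ Z)
    (h₁₂ : (B ◁ g) ▷ A'' ≫ a = (B ⊗ A') ◁ h ≫ b)
    (h₁₃ : (f ▷ B') ▷ A'' ≫ a = (A ⊗ B') ◁ h ≫ c)
    (h₂₃ : (f ▷ A') ▷ B'' ≫ b = (A ◁ g) ▷ B'' ≫ c)

@[simp]
theorem i₁_descI : i₁ f g h ≫ descI a b c h₁₂ h₁₃ h₂₃ = a := inl_desc _ _ _

theorem iR_descI : iR f g h ≫ descI a b c h₁₂ h₁₃ h₂₃ = descR b c h₂₃ := inr_desc _ _ _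

@[simp]
theorem i₂_descI : i₂ f g h ≫ descI a b c h₁₂ h₁₃ h₂₃ = b := by
  rw [i₂, Category.assoc, iR_descI, inl_descR]

@[simp]
theorem i₃_descI : i₃ f g h ≫ descI a b c h₁₂ h₁₃ h₂₃ = c := by
  rw [i₃, Category.assoc, iR_descI, inr_descR]

end

end Left

section Right

variable (f : A ⟶ B) (g : A' ⟶ B') (h : A'' ⟶ B'')

noncomputable def jL : B ⊗ corner g h ⟶ corner f (ppHom g h) := inl f (ppHom g h)

noncomputable def j₁ : B ⊗ B' ⊗ A'' ⟶ corner f (ppHom g h) :=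
  B ◁ inl g h ≫ jL f g h

noncomputable def j₂ : B ⊗ A' ⊗ B'' ⟶ corner f (ppHom g h) :=
  B ◁ inr g h ≫ jL f g h

noncomputable def j₃ : A ⊗ B' ⊗ B'' ⟶ corner f (ppHom g h) := inr f (ppHom g h)

theorem prod_condition' : f ▷ corner g h ≫ jL f g h =
    A ◁ ppHom g h ≫ j₃ f g h := condition f (ppHom g h)

theorem j₁₂ : B ◁ g ▷ A'' ≫ j₁ f g h =
    B ◁ A' ◁ h ≫ j₂ f g h := by
  rw [j₁, j₂, ← MonoidalCategory.whiskerLeft_comp_assoc, condition,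
    MonoidalCategory.whiskerLeft_comp_assoc]

theorem j₁₃ : f ▷ (B' ⊗ A'') ≫ j₁ f g h =
    A ◁ B' ◁ h ≫ j₃ f g h := by
  rw [← inl_ppHom g h, MonoidalCategory.whiskerLeft_comp_assoc, ← prod_condition', j₁,
    whisker_exchange_assoc]

theorem j₂₃ : f ▷ (A' ⊗ B'') ≫ j₂ f g h =
    A ◁ g ▷ B'' ≫ j₃ f g h := by
  rw [← inr_ppHom g h, MonoidalCategory.whiskerLeft_comp_assoc, ← prod_condition', j₂,
    whisker_exchange_assoc]

variable {f g h}

theorem ext_jL {Z : M} {a b : corner f (ppHom g h) ⟶ Z} (h₁ : jL f g h ≫ a = jL f g h ≫ b)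
    (h₃ : j₃ f g h ≫ a = j₃ f g h ≫ b) : a = b := corner_hom_ext h₁ h₃

theorem ext_j {Z : M} {a b : corner f (ppHom g h) ⟶ Z} (h₁ : j₁ f g h ≫ a = j₁ f g h ≫ b)
    (h₂ : j₂ f g h ≫ a = j₂ f g h ≫ b) (h₃ : j₃ f g h ≫ a = j₃ f g h ≫ b) : a = b :=
  ext_jL (left_hom_ext (by simpa [j₁] using h₁) (by simpa [j₂] using h₂)) h₃

noncomputable def descJ {Z : M} (a : B ⊗ B' ⊗ A'' ⟶ Z)
    (b : B ⊗ A' ⊗ B'' ⟶ Z) (c : A ⊗ B' ⊗ B'' ⟶ Z)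
    (h₁₂ : B ◁ g ▷ A'' ≫ a = B ◁ A' ◁ h ≫ b)
    (h₁₃ : f ▷ (B' ⊗ A'') ≫ a = A ◁ B' ◁ h ≫ c)
    (h₂₃ : f ▷ (A' ⊗ B'') ≫ b = A ◁ g ▷ B'' ≫ c) :
    corner f (ppHom g h) ⟶ Z :=
  desc (g := ppHom g h) (descL a b h₁₂) c (by
    show f ▷ corner g h ≫ descL a b h₁₂ = A ◁ ppHom g h ≫ c
    apply left_hom_ext
    · rw [← MonoidalCategory.whiskerLeft_comp_assoc, inl_ppHom, ← h₁₃, whisker_exchange_assoc,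
        inl_descL]
    · rw [← MonoidalCategory.whiskerLeft_comp_assoc, inr_ppHom, ← h₂₃, whisker_exchange_assoc,
        inr_descL])

section

variable {Z : M} (a : B ⊗ B' ⊗ A'' ⟶ Z)
    (b : B ⊗ A' ⊗ B'' ⟶ Z) (c : A ⊗ B' ⊗ B'' ⟶ Z)
    (h₁₂ : B ◁ g ▷ A'' ≫ a = B ◁ A' ◁ h ≫ b)
    (h₁₃ : f ▷ (B' ⊗ A'') ≫ a = A ◁ B' ◁ h ≫ c)
    (h₂₃ : f ▷ (A' ⊗ B'') ≫ b = A ◁ g ▷ B'' ≫ c)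

theorem jL_descJ : jL f g h ≫ descJ a b c h₁₂ h₁₃ h₂₃ = descL a b h₁₂ := inl_desc _ _ _

@[simp]
theorem j₁_descJ : j₁ f g h ≫ descJ a b c h₁₂ h₁₃ h₂₃ = a := by
  rw [j₁, Category.assoc, jL_descJ, inl_descL]

@[simp]
theorem j₂_descJ : j₂ f g h ≫ descJ a b c h₁₂ h₁₃ h₂₃ = b := by
  rw [j₂, Category.assoc, jL_descJ, inr_descL]

@[simp]
theorem j₃_descJ : j₃ f g h ≫ descJ a b c h₁₂ h₁₃ h₂₃ = c := inr_desc _ _ _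

end

end Right

/-- The associativity isomorphism on domains of pushout products. -/
noncomputable def assocCorner (f : A ⟶ B) (g : A' ⟶ B') (h : A'' ⟶ B'') :
    corner (ppHom f g) h ≅ corner f (ppHom g h) where
  hom := descI ((α_ _ _ _).hom ≫ j₁ f g h) ((α_ _ _ _).hom ≫ j₂ f g h)
    ((α_ _ _ _).hom ≫ j₃ f g h)
    (by rw [associator_naturality_middle_assoc, j₁₂, associator_naturality_right_assoc])
    (by rw [associator_naturality_left_assoc, j₁₃, associator_naturality_right_assoc])
    (by rw [associator_naturality_left_assoc, j₂₃, associator_naturality_middle_assoc])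
  inv := descJ ((α_ _ _ _).inv ≫ i₁ f g h) ((α_ _ _ _).inv ≫ i₂ f g h)
    ((α_ _ _ _).inv ≫ i₃ f g h)
    (by rw [associator_inv_naturality_middle_assoc, i₁₂, associator_inv_naturality_right_assoc])
    (by rw [associator_inv_naturality_left_assoc, i₁₃, associator_inv_naturality_right_assoc])
    (by rw [associator_inv_naturality_left_assoc, i₂₃, associator_inv_naturality_middle_assoc])
  hom_inv_id := by apply ext_i <;> simp [reassoc_of% @i₁_descI, reassoc_of% @i₂_descI, reassoc_of% @i₃_descI]
  inv_hom_id := by apply ext_j <;> simp [reassoc_of% @j₁_descJ, reassoc_of% @j₂_descJ, reassoc_of% @j₃_descJ]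

variable (f : A ⟶ B) (g : A' ⟶ B') (h : A'' ⟶ B'')

theorem j₁_ppHom : j₁ f g h ≫ ppHom f (ppHom g h) = B ◁ B' ◁ h := by
  rw [j₁, jL, Category.assoc, inl_ppHom, ← MonoidalCategory.whiskerLeft_comp, inl_ppHom]

theorem j₂_ppHom : j₂ f g h ≫ ppHom f (ppHom g h) = B ◁ g ▷ B'' := by
  rw [j₂, jL, Category.assoc, inl_ppHom, ← MonoidalCategory.whiskerLeft_comp, inr_ppHom]

theorem j₃_ppHom : j₃ f g h ≫ ppHom f (ppHom g h) = f ▷ (B' ⊗ B'') := inr_ppHom _ _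

theorem i₁_ppHom : i₁ f g h ≫ ppHom (ppHom f g) h = (B ⊗ B') ◁ h := inl_ppHom _ _

theorem i₂_ppHom : i₂ f g h ≫ ppHom (ppHom f g) h = (B ◁ g) ▷ B'' := by
  rw [i₂, iR, Category.assoc, inr_ppHom, ← comp_whiskerRight, inl_ppHom]

theorem i₃_ppHom : i₃ f g h ≫ ppHom (ppHom f g) h = (f ▷ B') ▷ B'' := by
  rw [i₃, iR, Category.assoc, inr_ppHom, ← comp_whiskerRight, inr_ppHom]

@[simp]
theorem i₁_assocCorner : i₁ f g h ≫ (assocCorner f g h).hom = (α_ _ _ _).hom ≫ j₁ f g h := by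
  rw [assocCorner, i₁_descI]

@[simp]
theorem i₂_assocCorner : i₂ f g h ≫ (assocCorner f g h).hom = (α_ _ _ _).hom ≫ j₂ f g h := by
  rw [assocCorner, i₂_descI]

@[simp]
theorem i₃_assocCorner : i₃ f g h ≫ (assocCorner f g h).hom = (α_ _ _ _).hom ≫ j₃ f g h := by
  rw [assocCorner, i₃_descI]

theorem assocCorner_ppHom : (assocCorner f g h).hom ≫ ppHom f (ppHom g h) =
    ppHom (ppHom f g) h ≫ (α_ B B' B'').hom := by
  apply ext_i
  · rw [reassoc_of% @i₁_assocCorner, j₁_ppHom, reassoc_of% @i₁_ppHom, associator_naturality_right]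
  · rw [reassoc_of% @i₂_assocCorner, j₂_ppHom, reassoc_of% @i₂_ppHom, associator_naturality_middle]
  · rw [reassoc_of% @i₃_assocCorner, j₃_ppHom, reassoc_of% @i₃_ppHom, associator_naturality_left]

section AssocNaturality

variable {f g h} {C D C' D' C'' D'' : M} {f₂ : C ⟶ D} {g₂ : C' ⟶ D'} {h₂ : C'' ⟶ D''}
  {a₀ : A ⟶ C} {a₁ : B ⟶ D} (ha : a₀ ≫ f₂ = f ≫ a₁)
  {b₀ : A' ⟶ C'} {b₁ : B' ⟶ D'} (hb : b₀ ≫ g₂ = g ≫ b₁)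
  {c₀ : A'' ⟶ C''} {c₁ : B'' ⟶ D''} (hc : c₀ ≫ h₂ = h ≫ c₁)

theorem i₁_map : i₁ f g h ≫ mapCorner (mapCorner_ppHom ha hb) hc =
    ((a₁ ⊗ₘ b₁) ⊗ₘ c₀) ≫ i₁ f₂ g₂ h₂ := inl_mapCorner _ _

theorem i₂_map : i₂ f g h ≫ mapCorner (mapCorner_ppHom ha hb) hc =
    ((a₁ ⊗ₘ b₀) ⊗ₘ c₁) ≫ i₂ f₂ g₂ h₂ := by
  rw [i₂, i₂, iR, iR, Category.assoc, inr_mapCorner, ← tensorHom_id, ← tensorHom_id,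
    tensorHom_comp_tensorHom_assoc, tensorHom_comp_tensorHom_assoc, inl_mapCorner,
    Category.id_comp, Category.comp_id]

theorem i₃_map : i₃ f g h ≫ mapCorner (mapCorner_ppHom ha hb) hc =
    ((a₀ ⊗ₘ b₁) ⊗ₘ c₁) ≫ i₃ f₂ g₂ h₂ := by
  rw [i₃, i₃, iR, iR, Category.assoc, inr_mapCorner, ← tensorHom_id, ← tensorHom_id,
    tensorHom_comp_tensorHom_assoc, tensorHom_comp_tensorHom_assoc, inr_mapCorner,
    Category.id_comp, Category.comp_id]

theorem j₁_map : j₁ f g h ≫ mapCorner ha (mapCorner_ppHom hb hc) =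
    (a₁ ⊗ₘ b₁ ⊗ₘ c₀) ≫ j₁ f₂ g₂ h₂ := by
  rw [j₁, j₁, jL, jL, Category.assoc, inl_mapCorner, ← id_tensorHom, ← id_tensorHom,
    tensorHom_comp_tensorHom_assoc, tensorHom_comp_tensorHom_assoc, inl_mapCorner,
    Category.id_comp, Category.comp_id]

theorem j₂_map : j₂ f g h ≫ mapCorner ha (mapCorner_ppHom hb hc) =
    (a₁ ⊗ₘ b₀ ⊗ₘ c₁) ≫ j₂ f₂ g₂ h₂ := by
  rw [j₂, j₂, jL, jL, Category.assoc, inl_mapCorner, ← id_tensorHom, ← id_tensorHom,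
    tensorHom_comp_tensorHom_assoc, tensorHom_comp_tensorHom_assoc, inr_mapCorner,
    Category.id_comp, Category.comp_id]

theorem j₃_map : j₃ f g h ≫ mapCorner ha (mapCorner_ppHom hb hc) =
    (a₀ ⊗ₘ b₁ ⊗ₘ c₁) ≫ j₃ f₂ g₂ h₂ := inr_mapCorner _ _

theorem assocCorner_naturality :
    mapCorner (mapCorner_ppHom ha hb) hc ≫ (assocCorner f₂ g₂ h₂).hom =
      (assocCorner f g h).hom ≫ mapCorner ha (mapCorner_ppHom hb hc) := by
  apply ext_i
  · rw [reassoc_of% @i₁_map, i₁_assocCorner, reassoc_of% @i₁_assocCorner, j₁_map, associator_naturality_assoc]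
  · rw [reassoc_of% @i₂_map, i₂_assocCorner, reassoc_of% @i₂_assocCorner, j₂_map, associator_naturality_assoc]
  · rw [reassoc_of% @i₃_map, i₃_assocCorner, reassoc_of% @i₃_assocCorner, j₃_map, associator_naturality_assoc]

end AssocNaturality

section Pentagon

theorem a₁ : inl (ppHom f g) h ≫ (assocCorner f g h).hom =
    (α_ _ _ _).hom ≫ B ◁ inl g h ≫ inl f (ppHom g h) := i₁_assocCorner f g h

theorem a₂ : inl f g ▷ B'' ≫ inr (ppHom f g) h ≫ (assocCorner f g h).hom =
    (α_ _ _ _).hom ≫ B ◁ inr g h ≫ inl f (ppHom g h) :=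
  (Category.assoc _ _ _).symm.trans (i₂_assocCorner f g h)

theorem a₃ : inr f g ▷ B'' ≫ inr (ppHom f g) h ≫ (assocCorner f g h).hom =
    (α_ _ _ _).hom ≫ inr f (ppHom g h) :=
  (Category.assoc _ _ _).symm.trans (i₃_assocCorner f g h)

variable {A₃ B₃ : M} (k : A₃ ⟶ B₃)

theorem ext_p {Z : M} {a b : corner (ppHom (ppHom f g) h) k ⟶ Z}
    (h₁ : i₁ (ppHom f g) h k ≫ a = i₁ (ppHom f g) h k ≫ b)
    (h₂ : i₂ (ppHom f g) h k ≫ a = i₂ (ppHom f g) h k ≫ b)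
    (h₃ : inl f g ▷ B'' ▷ B₃ ≫ i₃ (ppHom f g) h k ≫ a =
      inl f g ▷ B'' ▷ B₃ ≫ i₃ (ppHom f g) h k ≫ b)
    (h₄ : inr f g ▷ B'' ▷ B₃ ≫ i₃ (ppHom f g) h k ≫ a =
      inr f g ▷ B'' ▷ B₃ ≫ i₃ (ppHom f g) h k ≫ b) : a = b :=
  ext_i h₁ h₂ (((tensorRight B'' ⋙ tensorRight B₃).map_isPushout (isPushout f g)).hom_ext h₃ h₄)

theorem pentagon_corner :
    mapCorner (assocCorner_ppHom f g h) (Category.id_comp k |>.trans (Category.comp_id k).symm) ≫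
        (assocCorner f (ppHom g h) k).hom ≫
        mapCorner (Category.id_comp f |>.trans (Category.comp_id f).symm)
          (assocCorner_ppHom g h k) =
      (assocCorner (ppHom f g) h k).hom ≫ (assocCorner f g (ppHom h k)).hom := by
  apply ext_p
  · rw [i₁, reassoc_of% @inl_mapCorner, tensorHom_id, reassoc_of% @a₁, inl_mapCorner, id_tensorHom,
      ← MonoidalCategory.whiskerLeft_comp_assoc, a₁, reassoc_of% @a₁, a₁,
      associator_naturality_right_assoc, ← pentagon_assoc]
    simp only [MonoidalCategory.whiskerLeft_comp, Category.assoc]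
  · rw [i₂, iR, Category.assoc, Category.assoc, reassoc_of% @inr_mapCorner, tensorHom_id,
      ← comp_whiskerRight_assoc, a₁, comp_whiskerRight_assoc, comp_whiskerRight_assoc,
      reassoc_of% @a₂, inl_mapCorner, id_tensorHom, associator_naturality_middle_assoc,
      ← MonoidalCategory.whiskerLeft_comp_assoc, ← MonoidalCategory.whiskerLeft_comp_assoc,
      Category.assoc, a₂, reassoc_of% @a₂, a₁, associator_naturality_right_assoc, ← pentagon_assoc]
    simp only [MonoidalCategory.whiskerLeft_comp, Category.assoc]
  · rw [i₃, iR, Category.assoc, Category.assoc, reassoc_of% @inr_mapCorner, tensorHom_id,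
      ← comp_whiskerRight_assoc, ← comp_whiskerRight_assoc, Category.assoc, a₂,
      comp_whiskerRight_assoc, comp_whiskerRight_assoc,
      reassoc_of% @a₂, inl_mapCorner, id_tensorHom, associator_naturality_middle_assoc,
      ← MonoidalCategory.whiskerLeft_comp_assoc, ← MonoidalCategory.whiskerLeft_comp_assoc,
      Category.assoc, a₃, reassoc_of% @a₃, associator_naturality_left_assoc, a₂, ← pentagon_assoc]
    simp only [MonoidalCategory.whiskerLeft_comp, Category.assoc]
  · rw [i₃, iR, Category.assoc, Category.assoc, reassoc_of% @inr_mapCorner, tensorHom_id,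
      ← comp_whiskerRight_assoc, ← comp_whiskerRight_assoc, Category.assoc, a₃,
      comp_whiskerRight_assoc, reassoc_of% @a₃, inr_mapCorner, id_tensorHom, reassoc_of% @a₃,
      associator_naturality_left_assoc, a₃, ← pentagon_assoc]

end Pentagon

section Unit

theorem isInitial_left (W : M) : Nonempty (IsInitial (W ⊗ ⊥_ M)) :=
  ⟨IsInitial.isInitialObj (tensorLeft W) _ initialIsInitial⟩

theorem isInitial_right (W : M) : Nonempty (IsInitial ((⊥_ M) ⊗ W)) :=
  ⟨IsInitial.isInitialObj (tensorRight W) _ initialIsInitial⟩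

theorem tensor_initial_hom_ext {W Z : M} (a b : W ⊗ (⊥_ M) ⟶ Z) : a = b :=
  (isInitial_left W).some.hom_ext a b

theorem initial_tensor_hom_ext {W Z : M} (a b : (⊥_ M) ⊗ W ⟶ Z) : a = b :=
  (isInitial_right W).some.hom_ext a b

noncomputable def toOfInitialTensor (W Z : M) : (⊥_ M) ⊗ W ⟶ Z := (isInitial_right W).some.to Z

noncomputable def toOfTensorInitial (W Z : M) : W ⊗ (⊥_ M) ⟶ Z := (isInitial_left W).some.to Z

noncomputable def leftUnitorCorner (f : A ⟶ B) : corner (initial.to (𝟙_ M)) f ≅ A where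
  hom := desc (λ_ A).hom (toOfInitialTensor B A) (initial_tensor_hom_ext _ _)
  inv := (λ_ A).inv ≫ inl (initial.to (𝟙_ M)) f
  hom_inv_id := corner_hom_ext (by simp [reassoc_of% @inl_desc]) (initial_tensor_hom_ext _ _)
  inv_hom_id := by simp

noncomputable def rightUnitorCorner (f : A ⟶ B) : corner f (initial.to (𝟙_ M)) ≅ A where
  hom := desc (toOfTensorInitial B A) (ρ_ A).hom (tensor_initial_hom_ext _ _)
  inv := (ρ_ A).inv ≫ inr f (initial.to (𝟙_ M))
  hom_inv_id := corner_hom_ext (tensor_initial_hom_ext _ _) (by simp [reassoc_of% @inr_desc])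
  inv_hom_id := by simp

@[simp]
theorem inl_leftUnitorCorner (f : A ⟶ B) :
    inl (initial.to (𝟙_ M)) f ≫ (leftUnitorCorner f).hom = (λ_ A).hom := inl_desc _ _ _

@[simp]
theorem inr_rightUnitorCorner (f : A ⟶ B) :
    inr f (initial.to (𝟙_ M)) ≫ (rightUnitorCorner f).hom = (ρ_ A).hom := inr_desc _ _ _

theorem leftUnitorCorner_ppHom (f : A ⟶ B) :
    (leftUnitorCorner f).hom ≫ f = ppHom (initial.to (𝟙_ M)) f ≫ (λ_ B).hom :=
  corner_hom_ext (by simp [reassoc_of% @inl_ppHom, reassoc_of% @inl_leftUnitorCorner]) (initial_tensor_hom_ext _ _)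

theorem rightUnitorCorner_ppHom (f : A ⟶ B) :
    (rightUnitorCorner f).hom ≫ f = ppHom f (initial.to (𝟙_ M)) ≫ (ρ_ B).hom :=
  corner_hom_ext (tensor_initial_hom_ext _ _) 
    (by simp [reassoc_of% @inr_ppHom, reassoc_of% @inr_rightUnitorCorner])

theorem leftUnitorCorner_naturality {C D : M} {f : A ⟶ B} {f₂ : C ⟶ D} {a₀ : A ⟶ C}
    {a₁ : B ⟶ D} (ha : a₀ ≫ f₂ = f ≫ a₁)
    (hi : 𝟙 _ ≫ initial.to (𝟙_ M) = initial.to (𝟙_ M) ≫ 𝟙 _) :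
    mapCorner hi ha ≫ (leftUnitorCorner f₂).hom = (leftUnitorCorner f).hom ≫ a₀ :=
  corner_hom_ext (by rw [reassoc_of% @inl_mapCorner, inl_leftUnitorCorner, reassoc_of% @inl_leftUnitorCorner,
    id_tensorHom, leftUnitor_naturality]) (initial_tensor_hom_ext _ _)

theorem rightUnitorCorner_naturality {C D : M} {f : A ⟶ B} {f₂ : C ⟶ D} {a₀ : A ⟶ C}
    {a₁ : B ⟶ D} (ha : a₀ ≫ f₂ = f ≫ a₁)
    (hi : 𝟙 _ ≫ initial.to (𝟙_ M) = initial.to (𝟙_ M) ≫ 𝟙 _) :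
    mapCorner ha hi ≫ (rightUnitorCorner f₂).hom = (rightUnitorCorner f).hom ≫ a₀ :=
  corner_hom_ext (tensor_initial_hom_ext _ _) (by rw [reassoc_of% @inr_mapCorner, inr_rightUnitorCorner,
    reassoc_of% @inr_rightUnitorCorner, tensorHom_id, rightUnitor_naturality])

theorem triangle_corner :
    (assocCorner f (initial.to (𝟙_ M)) g).hom ≫
        mapCorner (Category.id_comp f |>.trans (Category.comp_id f).symm)
          (leftUnitorCorner_ppHom g) =
      mapCorner (rightUnitorCorner_ppHom f)
        (Category.id_comp g |>.trans (Category.comp_id g).symm) := by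
  apply ext_i
  · rw [reassoc_of% @i₁_assocCorner, j₁, i₁, jL, Category.assoc, inl_mapCorner, inl_mapCorner, ← id_tensorHom,
      tensorHom_comp_tensorHom_assoc, inl_leftUnitorCorner]
    simp
  · exact (IsInitial.isInitialObj (tensorLeft B ⋙ tensorRight B') _ initialIsInitial).hom_ext _ _
  · rw [reassoc_of% @i₃_assocCorner, j₃, i₃, iR, Category.assoc, inr_mapCorner, inr_mapCorner, ← tensorHom_id,
      tensorHom_comp_tensorHom_assoc, inr_rightUnitorCorner]
    simp

end Unit

section Braiding

noncomputable def braidCorner (f : A ⟶ B) (g : A' ⟶ B') : corner f g ≅ corner g f where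
  hom := desc ((β_ B A').hom ≫ inr g f) ((β_ A B').hom ≫ inl g f) (by
    rw [BraidedCategory.braiding_naturality_left_assoc,
      BraidedCategory.braiding_naturality_right_assoc, condition])
  inv := desc ((β_ A B').inv ≫ inr f g) ((β_ B A').inv ≫ inl f g) (by
    rw [BraidedCategory.braiding_inv_naturality_left_assoc,
      BraidedCategory.braiding_inv_naturality_right_assoc, condition])
  hom_inv_id := by apply corner_hom_ext <;> simp [reassoc_of% @inl_desc, reassoc_of% @inr_desc]
  inv_hom_id := by apply corner_hom_ext <;> simp [reassoc_of% @inl_desc, reassoc_of% @inr_desc]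

@[simp]
theorem inl_braidCorner (f : A ⟶ B) (g : A' ⟶ B') :
    inl f g ≫ (braidCorner f g).hom = (β_ B A').hom ≫ inr g f := inl_desc _ _ _

@[simp]
theorem inr_braidCorner (f : A ⟶ B) (g : A' ⟶ B') :
    inr f g ≫ (braidCorner f g).hom = (β_ A B').hom ≫ inl g f := inr_desc _ _ _

theorem braidCorner_ppHom (f : A ⟶ B) (g : A' ⟶ B') :
    (braidCorner f g).hom ≫ ppHom g f = ppHom f g ≫ (β_ B B').hom := by
  apply corner_hom_ext <;> simp [reassoc_of% @inl_ppHom, reassoc_of% @inr_ppHom,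
    reassoc_of% @inl_braidCorner, reassoc_of% @inr_braidCorner]

theorem braidCorner_symm (f : A ⟶ B) (g : A' ⟶ B') :
    (braidCorner f g).hom ≫ (braidCorner g f).hom = 𝟙 _ := by
  apply corner_hom_ext <;> simp [reassoc_of% @inl_braidCorner, reassoc_of% @inr_braidCorner]

section

variable {f g} {C D C' D' : M} {f₂ : C ⟶ D} {g₂ : C' ⟶ D'}
  {a₀ : A ⟶ C} {a₁ : B ⟶ D} (ha : a₀ ≫ f₂ = f ≫ a₁)
  {b₀ : A' ⟶ C'} {b₁ : B' ⟶ D'} (hb : b₀ ≫ g₂ = g ≫ b₁)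

theorem braidCorner_naturality :
    mapCorner ha hb ≫ (braidCorner f₂ g₂).hom = (braidCorner f g).hom ≫ mapCorner hb ha := by
  apply corner_hom_ext
  · rw [reassoc_of% @inl_mapCorner, inl_braidCorner, reassoc_of% @inl_braidCorner, inr_mapCorner,
      BraidedCategory.braiding_naturality_assoc]
  · rw [reassoc_of% @inr_mapCorner, inr_braidCorner, reassoc_of% @inr_braidCorner, inl_mapCorner,
      BraidedCategory.braiding_naturality_assoc]

end

theorem hexagon_forward_corner :
    (assocCorner f g h).hom ≫ (braidCorner f (ppHom g h)).hom ≫ (assocCorner g h f).hom =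
      mapCorner (braidCorner_ppHom f g) (Category.id_comp h |>.trans (Category.comp_id h).symm) ≫
        (assocCorner g f h).hom ≫
        mapCorner (Category.id_comp g |>.trans (Category.comp_id g).symm)
          (braidCorner_ppHom f h) := by
  apply ext_i
  · rw [i₁, reassoc_of% @inl_mapCorner, tensorHom_id, reassoc_of% @a₁, reassoc_of% @inl_braidCorner,
      reassoc_of% @a₁, inl_mapCorner, id_tensorHom,
      BraidedCategory.braiding_naturality_right_assoc, a₂, ← MonoidalCategory.whiskerLeft_comp_assoc,
      inl_braidCorner, MonoidalCategory.whiskerLeft_comp_assoc,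
      BraidedCategory.hexagon_forward_assoc]
  · rw [i₂, iR, Category.assoc, Category.assoc, reassoc_of% @a₂, reassoc_of% @inl_braidCorner,
      BraidedCategory.braiding_naturality_right_assoc, a₃, reassoc_of% @inr_mapCorner, tensorHom_id,
      ← comp_whiskerRight_assoc, inl_braidCorner, comp_whiskerRight_assoc, reassoc_of% @a₃,
      inr_mapCorner, id_tensorHom, BraidedCategory.hexagon_forward_assoc]
  · rw [i₃, iR, Category.assoc, Category.assoc, reassoc_of% @a₃, reassoc_of% @inr_braidCorner,
      a₁, reassoc_of% @inr_mapCorner, tensorHom_id,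
      ← comp_whiskerRight_assoc, inr_braidCorner, comp_whiskerRight_assoc, reassoc_of% @a₂,
      inl_mapCorner, id_tensorHom, ← MonoidalCategory.whiskerLeft_comp_assoc, inr_braidCorner,
      MonoidalCategory.whiskerLeft_comp_assoc, BraidedCategory.hexagon_forward_assoc]


end Braiding

end Assoc
end PushoutProductArrow
end PushoutProductArrow

section Combinators

variable {M : Type u} [Category.{v} M] [MonoidalCategory M] [HasPushouts M]

namespace PushoutProductArrow

variable {A B A' B' C D C' D' E F E' F' : M} {f : A ⟶ B} {f₂ : C ⟶ D} {f₃ : E ⟶ F}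
  {g : A' ⟶ B'} {g₂ : C' ⟶ D'} {g₃ : E' ⟶ F'}

theorem mapCorner_id (h₁ : 𝟙 A ≫ f = f ≫ 𝟙 B) (h₂ : 𝟙 A' ≫ g = g ≫ 𝟙 B') :
    mapCorner h₁ h₂ = 𝟙 (corner f g) := by
  apply corner_hom_ext
  · rw [inl_mapCorner, id_tensorHom_id, Category.id_comp, Category.comp_id]
  · rw [inr_mapCorner, id_tensorHom_id, Category.id_comp, Category.comp_id]

theorem mapCorner_comp {a₀ : A ⟶ C} {a₁ : B ⟶ D} {b₀ : A' ⟶ C'} {b₁ : B' ⟶ D'}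
    {c₀ : C ⟶ E} {c₁ : D ⟶ F} {d₀ : C' ⟶ E'} {d₁ : D' ⟶ F'}
    (ha : a₀ ≫ f₂ = f ≫ a₁) (hb : b₀ ≫ g₂ = g ≫ b₁)
    (hc : c₀ ≫ f₃ = f₂ ≫ c₁) (hd : d₀ ≫ g₃ = g₂ ≫ d₁)
    (he : (a₀ ≫ c₀) ≫ f₃ = f ≫ a₁ ≫ c₁) (hf : (b₀ ≫ d₀) ≫ g₃ = g ≫ b₁ ≫ d₁) :
    mapCorner ha hb ≫ mapCorner hc hd = mapCorner he hf := by
  apply corner_hom_ext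
  · rw [reassoc_of% @inl_mapCorner, inl_mapCorner, inl_mapCorner, tensorHom_comp_tensorHom_assoc]
  · rw [reassoc_of% @inr_mapCorner, inr_mapCorner, inr_mapCorner, tensorHom_comp_tensorHom_assoc]

end PushoutProductArrow
end Combinators

section PushoutProductMonoidal

variable {M : Type u} [Category.{v} M] [MonoidalCategory M]

namespace PushoutProductArrow

variable [SymmetricCategory M] [HasFiniteColimits M]
  [∀ W : M, PreservesFiniteColimits (tensorLeft W)]

/-- The pushout product of two commutative squares. -/
noncomputable def prodHom {f f' g g' : Arrow M} (a : f ⟶ f') (b : g ⟶ g') :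
    Arrow.mk (ppHom f.hom g.hom) ⟶ Arrow.mk (ppHom f'.hom g'.hom) :=
  Arrow.homMk (mapCorner (Arrow.w a) (Arrow.w b)) (a.right ⊗ₘ b.right)
    (mapCorner_ppHom (Arrow.w a) (Arrow.w b))

/-- The pushout product of arrows, with unit `⊥ ⟶ 𝟙`. -/
@[reducible] noncomputable def monoidalStruct : MonoidalCategoryStruct (Arrow M) where
  tensorObj f g := Arrow.mk (ppHom f.hom g.hom)
  whiskerLeft f _ _ h := prodHom (𝟙 f) h
  whiskerRight h g := prodHom h (𝟙 g)
  tensorHom h k := prodHom h k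
  tensorUnit := Arrow.mk (initial.to (𝟙_ M))
  associator f g h := Arrow.isoMk (assocCorner f.hom g.hom h.hom)
    (α_ f.right g.right h.right) (assocCorner_ppHom f.hom g.hom h.hom)
  leftUnitor f := Arrow.isoMk (leftUnitorCorner f.hom) (λ_ f.right)
    (leftUnitorCorner_ppHom f.hom)
  rightUnitor f := Arrow.isoMk (rightUnitorCorner f.hom) (ρ_ f.right)
    (rightUnitorCorner_ppHom f.hom)

theorem mk_whiskerLeft (f : Arrow M) {g g' : Arrow M} (b : g ⟶ g') :
    (prodHom (𝟙 f) b).right = f.right ◁ b.right := id_tensorHom _ _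

theorem mk_whiskerRight {f f' : Arrow M} (a : f ⟶ f') (g : Arrow M) :
    (prodHom a (𝟙 g)).right = a.right ▷ g.right := tensorHom_id _ _

theorem prodHom_id (f g : Arrow M) : prodHom (𝟙 f) (𝟙 g) = 𝟙 _ :=
  arrow_hom_ext (mapCorner_id (Arrow.w (𝟙 f)) (Arrow.w (𝟙 g))) (id_tensorHom_id f.right g.right)

theorem prodHom_comp {f f' f'' g g' g'' : Arrow M} (a : f ⟶ f') (b : g ⟶ g')
    (a' : f' ⟶ f'') (b' : g' ⟶ g'') :
    prodHom a b ≫ prodHom a' b' = prodHom (a ≫ a') (b ≫ b') :=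
  arrow_hom_ext (mapCorner_comp (Arrow.w a) (Arrow.w b) (Arrow.w a') (Arrow.w b')
    (Arrow.w (a ≫ a')) (Arrow.w (b ≫ b')))
    (tensorHom_comp_tensorHom a.right b.right a'.right b'.right)

/-- The monoidal structure on the arrow category given by the pushout product, with unit `⊥ ⟶ 𝟙`. -/
@[reducible] noncomputable def monoidalCategory : MonoidalCategory (Arrow M) where
  __ := monoidalStruct
  tensorHom_def a b := by
    refine Eq.trans ?_ (prodHom_comp a (𝟙 _) (𝟙 _) b).symm
    rw [Category.id_comp, Category.comp_id]
    rfl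
  id_tensorHom_id f g := prodHom_id f g
  tensorHom_comp_tensorHom a b c d := prodHom_comp a b c d
  whiskerLeft_id f g := prodHom_id f g
  id_whiskerRight f g := prodHom_id f g
  associator_naturality a b c := arrow_hom_ext
    (assocCorner_naturality (Arrow.w a) (Arrow.w b) (Arrow.w c))
    (associator_naturality a.right b.right c.right)
  leftUnitor_naturality a := arrow_hom_ext
    (leftUnitorCorner_naturality (Arrow.w a) (Arrow.w (𝟙 (Arrow.mk (initial.to (𝟙_ M))))))
    ((congrArg (fun x => x ≫ _) (id_tensorHom _ _)).trans (leftUnitor_naturality a.right))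
  rightUnitor_naturality a := arrow_hom_ext
    (rightUnitorCorner_naturality (Arrow.w a) (Arrow.w (𝟙 (Arrow.mk (initial.to (𝟙_ M))))))
    ((congrArg (fun x => x ≫ _) (tensorHom_id _ _)).trans (rightUnitor_naturality a.right))
  pentagon f g h k := arrow_hom_ext
    (pentagon_corner f.hom g.hom h.hom k.hom)
    ((congrArg₂ (fun x y => x ≫ _ ≫ y) (tensorHom_id _ _) (id_tensorHom _ _)).trans
      (pentagon f.right g.right h.right k.right))
  triangle f g := arrow_hom_ext
    (triangle_corner f.hom g.hom)
    ((congrArg (fun x => _ ≫ x) (id_tensorHom _ _)).trans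
      ((triangle f.right g.right).trans (tensorHom_id _ _).symm))

section Symmetric

attribute [local instance] monoidalCategory

noncomputable def braidIso (f g : Arrow M) : f ⊗ g ≅ g ⊗ f :=
  Arrow.isoMk (braidCorner f.hom g.hom) (β_ f.right g.right) (braidCorner_ppHom f.hom g.hom)

theorem hexagon_forward_arrow (f g h : Arrow M) :
    (α_ f g h).hom ≫ (braidIso f (g ⊗ h)).hom ≫ (α_ g h f).hom =
      (braidIso f g).hom ▷ h ≫ (α_ g f h).hom ≫ g ◁ (braidIso f h).hom :=
  arrow_hom_ext (hexagon_forward_corner f.hom g.hom h.hom)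
    ((BraidedCategory.hexagon_forward f.right g.right h.right).trans
      (congrArg₂ (fun x y => x ≫ _ ≫ y) (tensorHom_id _ _) (id_tensorHom _ _)).symm)

theorem braidIso_symm (f g : Arrow M) : (braidIso f g).hom ≫ (braidIso g f).hom = 𝟙 _ :=
  arrow_hom_ext (braidCorner_symm f.hom g.hom) (SymmetricCategory.symmetry f.right g.right)

theorem braidIso_inv (f g : Arrow M) : (braidIso f g).inv = (braidIso g f).hom := by
  rw [← cancel_epi (braidIso f g).hom, Iso.hom_inv_id, braidIso_symm]

theorem hexagon_reverse_arrow (f g h : Arrow M) :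
    (α_ f g h).inv ≫ (braidIso (f ⊗ g) h).hom ≫ (α_ h f g).inv =
      f ◁ (braidIso g h).hom ≫ (α_ f h g).inv ≫ (braidIso f h).hom ▷ g := by
  have e : (α_ h f g ≪≫ braidIso h (f ⊗ g) ≪≫ α_ f g h) =
      whiskerRightIso (braidIso h f) g ≪≫ α_ f h g ≪≫ whiskerLeftIso f (braidIso h g) :=
    Iso.ext (hexagon_forward_arrow h f g)
  have e' := congrArg Iso.inv e
  rw [← braidIso_inv, ← braidIso_inv, ← braidIso_inv]
  simpa only [Iso.trans_inv, whiskerLeftIso_inv, whiskerRightIso_inv, Category.assoc] using e'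

@[reducible] noncomputable def symmetricCategory :
    SymmetricCategory (Arrow M) :=
  { braiding := fun f g => braidIso f g
    braiding_naturality_right := fun f _ _ b =>
      arrow_hom_ext (braidCorner_naturality (Arrow.w (𝟙 f)) (Arrow.w b))
        (BraidedCategory.braiding_naturality (𝟙 f.right) b.right)
    braiding_naturality_left := fun a g =>
      arrow_hom_ext (braidCorner_naturality (Arrow.w a) (Arrow.w (𝟙 g)))
        (BraidedCategory.braiding_naturality a.right (𝟙 g.right))
    hexagon_forward := hexagon_forward_arrow
    hexagon_reverse := hexagon_reverse_arrow
    symmetry := braidIso_symm }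

end Symmetric

end PushoutProductArrow
end PushoutProductMonoidal

section ArrowCategories

variable (M : Type u) [Category.{v} M]

/-- The arrow category of `M`, regarded as a monoidal category under the entrywise tensor
product. -/
def TensorArrow : Type (max u v) := Arrow M

/-- The arrow category of `M`, regarded as a monoidal category under the pushout product. -/
def PushoutArrow : Type (max u v) := Arrow M

instance : Category.{v} (TensorArrow M) := inferInstanceAs (Category (Arrow M))

instance : Category.{v} (PushoutArrow M) := inferInstanceAs (Category (Arrow M))

variable [MonoidalCategory M]

instance : MonoidalCategory (TensorArrow M) := TensorArrow.monoidalCategory (M := M)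

instance [SymmetricCategory M] : SymmetricCategory (TensorArrow M) :=
  TensorArrow.symmetricCategory (M := M)

variable [SymmetricCategory M] [HasFiniteColimits M]
  [∀ W : M, PreservesFiniteColimits (tensorLeft W)]

noncomputable instance : MonoidalCategory (PushoutArrow M) :=
  PushoutProductArrow.monoidalCategory (M := M)

noncomputable instance : SymmetricCategory (PushoutArrow M) :=
  PushoutProductArrow.symmetricCategory (M := M)

end ArrowCategories

section TensorIdentities

variable {M : Type u} [Category.{v} M] [MonoidalCategory M]

theorem tensor_id_assoc (X Y Z : M) : 𝟙 (X ⊗ Y) ▷ Z ≫ 𝟙 ((X ⊗ Y) ⊗ Z) ≫ (α_ X Y Z).hom =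
    (α_ X Y Z).hom ≫ X ◁ 𝟙 (Y ⊗ Z) ≫ 𝟙 (X ⊗ Y ⊗ Z) := by simp

theorem tensor_id_left (X : M) :
    (λ_ X).hom = 𝟙 (𝟙_ M) ▷ X ≫ 𝟙 (𝟙_ M ⊗ X) ≫ (λ_ X).hom := by simp

theorem tensor_id_right (X : M) :
    (ρ_ X).hom = X ◁ 𝟙 (𝟙_ M) ≫ 𝟙 (X ⊗ 𝟙_ M) ≫ (ρ_ X).hom := by simp

end TensorIdentities

section IdentityArrow

variable (M : Type u) [Category.{v} M]

/-- The functor `L₀` sending `X` to the identity arrow of `X`. -/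
def idArrow : M ⥤ TensorArrow M where
  obj X := Arrow.mk (𝟙 X)
  map f := Arrow.homMk f f ((Category.comp_id f).trans (Category.id_comp f).symm)
  map_id _ := arrow_hom_ext rfl rfl
  map_comp _ _ := arrow_hom_ext rfl rfl

/-- The functor sending an arrow to its domain. -/
def domain : TensorArrow M ⥤ M where
  obj f := Arrow.leftFunc.obj (show Arrow M from f)
  map a := Arrow.Hom.left (T := M) a
  map_id _ := rfl
  map_comp _ _ := rfl

variable [MonoidalCategory M]

instance : (idArrow M).LaxMonoidal where
  ε := 𝟙 (Arrow.mk (𝟙 (𝟙_ M)))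
  μ X Y := Arrow.homMk (f := Arrow.mk (𝟙 X ⊗ₘ 𝟙 Y)) (g := Arrow.mk (𝟙 (X ⊗ Y)))
    (𝟙 (X ⊗ Y)) (𝟙 (X ⊗ Y)) (by
      show 𝟙 (X ⊗ Y) ≫ 𝟙 (X ⊗ Y) = (𝟙 X ⊗ₘ 𝟙 Y) ≫ 𝟙 (X ⊗ Y)
      rw [id_tensorHom_id])
  μ_natural_left {X Y} f X' := by
    have h : f ▷ X' ≫ 𝟙 (Y ⊗ X') = 𝟙 (X ⊗ X') ≫ f ▷ X' := by simp
    exact arrow_hom_ext h h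
  μ_natural_right {X Y} X' f := by
    have h : X' ◁ f ≫ 𝟙 (X' ⊗ Y) = 𝟙 (X' ⊗ X) ≫ X' ◁ f := by simp
    exact arrow_hom_ext h h
  associativity X Y Z := by
    have h : 𝟙 (X ⊗ Y) ▷ Z ≫ 𝟙 ((X ⊗ Y) ⊗ Z) ≫ (α_ X Y Z).hom =
      (α_ X Y Z).hom ≫ X ◁ 𝟙 (Y ⊗ Z) ≫ 𝟙 (X ⊗ Y ⊗ Z) := by simp
    exact arrow_hom_ext h h
  left_unitality X := by
    have h : (λ_ X).hom = 𝟙 (𝟙_ M) ▷ X ≫ 𝟙 (𝟙_ M ⊗ X) ≫ (λ_ X).hom := by simp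
    exact arrow_hom_ext h h
  right_unitality X := by
    have h : (ρ_ X).hom = X ◁ 𝟙 (𝟙_ M) ≫ 𝟙 (X ⊗ 𝟙_ M) ≫ (ρ_ X).hom := by simp
    exact arrow_hom_ext h h

instance [SymmetricCategory M] : (idArrow M).LaxBraided where
  braided X Y := by
    have h : 𝟙 (X ⊗ Y) ≫ (β_ X Y).hom = (β_ X Y).hom ≫ 𝟙 (Y ⊗ X) := by simp
    exact arrow_hom_ext h h

instance : (domain M).LaxMonoidal where
  ε := 𝟙 (𝟙_ M)
  μ f g := 𝟙 ((domain M).obj f ⊗ (domain M).obj g)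
  μ_natural_left _ _ := (Category.comp_id _).trans (Category.id_comp _).symm
  μ_natural_right _ _ := (Category.comp_id _).trans (Category.id_comp _).symm
  associativity f g h := tensor_id_assoc ((domain M).obj f) ((domain M).obj g) ((domain M).obj h)
  left_unitality f := tensor_id_left ((domain M).obj f)
  right_unitality f := tensor_id_right ((domain M).obj f)

instance [SymmetricCategory M] : (domain M).LaxBraided where
  braided _ _ := (Category.id_comp _).trans (Category.comp_id _).symm

end IdentityArrow

section InitialArrow

variable (M : Type u) [Category.{v} M] [HasInitial M]

/-- The functor `L₁` sending `X` to the unique arrow from the initial object to `X`. -/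
noncomputable def initialArrow : M ⥤ PushoutArrow M where
  obj X := Arrow.mk (initial.to X)
  map f := Arrow.homMk (𝟙 (⊥_ M)) f (initialIsInitial.hom_ext _ _)
  map_id _ := arrow_hom_ext rfl rfl
  map_comp _ _ := arrow_hom_ext (Category.id_comp _).symm rfl

end InitialArrow

section Codomain

variable (M : Type u) [Category.{v} M]

/-- The functor sending an arrow to its codomain. -/
def codomain : PushoutArrow M ⥤ M where
  obj f := Arrow.rightFunc.obj (show Arrow M from f)
  map a := Arrow.Hom.right (T := M) a
  map_id _ := rfl
  map_comp _ _ := rfl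

variable [MonoidalCategory M] [SymmetricCategory M] [HasFiniteColimits M]
  [∀ W : M, PreservesFiniteColimits (tensorLeft W)]

noncomputable instance : (codomain M).LaxMonoidal where
  ε := 𝟙 (𝟙_ M)
  μ f g := 𝟙 ((codomain M).obj f ⊗ (codomain M).obj g)
  μ_natural_left _ _ := (Category.comp_id _).trans
    ((tensorHom_id _ _).symm.trans (Category.id_comp _).symm)
  μ_natural_right _ _ := (Category.comp_id _).trans
    ((id_tensorHom _ _).symm.trans (Category.id_comp _).symm)
  associativity f g h := tensor_id_assoc ((codomain M).obj f) ((codomain M).obj g) ((codomain M).obj h)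
  left_unitality f := tensor_id_left ((codomain M).obj f)
  right_unitality f := tensor_id_right ((codomain M).obj f)

noncomputable instance : (codomain M).LaxBraided where
  braided _ _ := (Category.id_comp _).trans (Category.comp_id _).symm

namespace PushoutProductArrow

variable {M} {A B A' B' : M}

theorem corner_initial_ext {f : A ⟶ B} {g : A' ⟶ B'} (hA : IsInitial A) (hA' : IsInitial A')
    {Z : M} (a b : corner f g ⟶ Z) : a = b :=
  corner_hom_ext ((hA'.isInitialObj (tensorLeft B)).hom_ext _ _)
    ((hA.isInitialObj (tensorRight B')).hom_ext _ _)

noncomputable def cornerInitialTo {f : A ⟶ B} {g : A' ⟶ B'} (hA : IsInitial A)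
    (hA' : IsInitial A') (Z : M) : corner f g ⟶ Z :=
  desc ((hA'.isInitialObj (tensorLeft B)).to Z) ((hA.isInitialObj (tensorRight B')).to Z)
    ((hA'.isInitialObj (tensorLeft A)).hom_ext _ _)

noncomputable def cornerIsInitial {f : A ⟶ B} {g : A' ⟶ B'} (hA : IsInitial A)
    (hA' : IsInitial A') : IsInitial (corner f g) :=
  IsInitial.ofUniqueHom (cornerInitialTo hA hA') (fun _ _ => corner_initial_ext hA hA' _ _)

noncomputable def initialCorner (X Y : M) : IsInitial (corner (initial.to X) (initial.to Y)) :=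
  cornerIsInitial initialIsInitial initialIsInitial

end PushoutProductArrow

open PushoutProductArrow

noncomputable instance : (initialArrow M).LaxMonoidal where
  ε := 𝟙 (Arrow.mk (initial.to (𝟙_ M)))
  μ X Y := Arrow.homMk (f := Arrow.mk (ppHom (initial.to X) (initial.to Y)))
    (g := Arrow.mk (initial.to (X ⊗ Y))) ((initialCorner X Y).to (⊥_ M)) (𝟙 (X ⊗ Y))
    ((initialCorner X Y).hom_ext _ _)
  μ_natural_left {X Y} f X' := by
    have h : (f ⊗ₘ 𝟙 X') ≫ 𝟙 (Y ⊗ X') = 𝟙 (X ⊗ X') ≫ f ▷ X' := by simp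
    exact arrow_hom_ext ((initialCorner X X').hom_ext _ _) h
  μ_natural_right {X Y} X' f := by
    have h : (𝟙 X' ⊗ₘ f) ≫ 𝟙 (X' ⊗ Y) = 𝟙 (X' ⊗ X) ≫ X' ◁ f := by simp
    exact arrow_hom_ext ((initialCorner X' X).hom_ext _ _) h
  associativity X Y Z := by
    have h : (𝟙 (X ⊗ Y) ⊗ₘ 𝟙 Z) ≫ 𝟙 ((X ⊗ Y) ⊗ Z) ≫ (α_ X Y Z).hom =
      (α_ X Y Z).hom ≫ (𝟙 X ⊗ₘ 𝟙 (Y ⊗ Z)) ≫ 𝟙 (X ⊗ Y ⊗ Z) := by simp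
    exact arrow_hom_ext ((cornerIsInitial (initialCorner X Y) initialIsInitial).hom_ext _ _) h
  left_unitality X := by
    have h : (λ_ X).hom = (𝟙 (𝟙_ M) ⊗ₘ 𝟙 X) ≫ 𝟙 (𝟙_ M ⊗ X) ≫ (λ_ X).hom := by simp
    exact arrow_hom_ext ((initialCorner (𝟙_ M) X).hom_ext _ _) h
  right_unitality X := by
    have h : (ρ_ X).hom = (𝟙 X ⊗ₘ 𝟙 (𝟙_ M)) ≫ 𝟙 (X ⊗ 𝟙_ M) ≫ (ρ_ X).hom := by simp
    exact arrow_hom_ext ((initialCorner X (𝟙_ M)).hom_ext _ _) h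

noncomputable instance : (initialArrow M).LaxBraided where
  braided X Y := by
    have h : 𝟙 (X ⊗ Y) ≫ (β_ X Y).hom = (β_ X Y).hom ≫ 𝟙 (Y ⊗ X) := by simp
    exact arrow_hom_ext ((initialCorner X Y).hom_ext _ _) h

end Codomain

section CokernelKernel

variable (M : Type u) [Category.{v} M] [HasZeroMorphisms M]

/-- The functor sending an arrow `f : X ⟶ Y` to its cokernel `Y ⟶ coker f`. -/
noncomputable def arrowCoker [HasCokernels M] : Arrow M ⥤ Arrow M where
  obj f := Arrow.mk (cokernel.π f.hom)
  map {f g} a := Arrow.homMk a.right (cokernel.map f.hom g.hom a.left a.right (Arrow.w a).symm)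
    (cokernel.π_desc _ _ _).symm
  map_id f := arrow_hom_ext rfl (coequalizer.hom_ext (by simp))
  map_comp a b := arrow_hom_ext rfl (coequalizer.hom_ext (by simp))

/-- The functor sending an arrow `g : A ⟶ B` to its kernel `ker g ⟶ A`. -/
noncomputable def arrowKer [HasKernels M] : Arrow M ⥤ Arrow M where
  obj g := Arrow.mk (kernel.ι g.hom)
  map {f g} a := Arrow.homMk (kernel.map f.hom g.hom a.left a.right (Arrow.w a).symm) a.left
    (kernel.lift_ι _ _ _)
  map_id f := arrow_hom_ext (equalizer.hom_ext (by simp)) rfl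
  map_comp a b := arrow_hom_ext (equalizer.hom_ext (by simp)) rfl

/-- The cokernel functor is left adjoint to the kernel functor. The unit at `f : X ⟶ Y` is the
map `X ⟶ ker (Y ⟶ coker f)` on domains and the identity of `Y` on codomains; the counit at
`g : A ⟶ B` is the identity of `A` on domains and the map `coker (ker g ⟶ A) ⟶ B` on
codomains. -/
noncomputable def arrowCokerKerAdj [HasCokernels M] [HasKernels M] :
    arrowCoker M ⊣ arrowKer M where
  unit :=
    { app f := Arrow.homMk (f := f) (g := Arrow.mk (kernel.ι (cokernel.π f.hom)))
        (kernel.lift (cokernel.π f.hom) f.hom (cokernel.condition _)) (𝟙 _) (by simp)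
      naturality f g a := arrow_hom_ext
        ((cancel_mono (kernel.ι (cokernel.π g.hom))).1 (by simp [arrowKer, arrowCoker]))
        (by simp [arrowKer, arrowCoker]) }
  counit :=
    { app g := Arrow.homMk (f := Arrow.mk (cokernel.π (kernel.ι g.hom))) (g := g)
        (𝟙 _) (cokernel.desc (kernel.ι g.hom) g.hom (kernel.condition _)) (by simp)
      naturality f g a := arrow_hom_ext (by simp [arrowKer, arrowCoker])
        ((cancel_epi (cokernel.π (kernel.ι f.hom))).1 (by simp [arrowKer, arrowCoker])) }
  left_triangle_components f := arrow_hom_ext (by simp [arrowKer, arrowCoker])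
    (coequalizer.hom_ext (by simp [arrowKer, arrowCoker]))
  right_triangle_components g := arrow_hom_ext
    ((cancel_mono (kernel.ι g.hom)).1 (by
      simp [arrowKer, arrowCoker]
      exact kernel.lift_ι _ _ _)) (by simp [arrowKer, arrowCoker])

/-- The cokernel functor, from the pushout product to the tensor product arrow category. -/
noncomputable def hoveyCoker [HasCokernels M] : PushoutArrow M ⥤ TensorArrow M := arrowCoker M

/-- The kernel functor, from the tensor product to the pushout product arrow category. -/
noncomputable def hoveyKer [HasKernels M] : TensorArrow M ⥤ PushoutArrow M := arrowKer M

/-- The adjunction between the cokernel and the kernel functor on arrow categories. -/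
noncomputable def hoveyAdj [HasCokernels M] [HasKernels M] :
    hoveyCoker M ⊣ hoveyKer M :=
  arrowCokerKerAdj M

end CokernelKernel

section AlgebraMap

open Functor.LaxMonoidal

variable {C : Type w} {V : Type u} [Category.{v} V] [MonoidalCategory V] [SymmetricCategory V]
  {W : Type u'} [Category.{v'} W] [MonoidalCategory W] [SymmetricCategory W]

namespace ColoredOperad

namespace Algebra

theorem map_assoc (F : V ⥤ W) [F.LaxBraided] {O : ColoredOperad C V} (A : O.Algebra)
    (L : List (List C × C)) (d : C) :
    F.obj (O.entry (L.map Prod.snd) d) ◁ tensMap (fun q : List C × C =>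
          F.obj (O.entry q.1 q.2) ◁ tensLax F A.obj q.1 ≫ μ F _ _ ≫ F.map (A.act q.1 q.2)) L ≫
        F.obj (O.entry (L.map Prod.snd) d) ◁ tensReindex Prod.snd (fun c => F.obj (A.obj c)) L ≫
        (F.obj (O.entry (L.map Prod.snd) d) ◁ tensLax F A.obj (L.map Prod.snd) ≫ μ F _ _ ≫
          F.map (A.act (L.map Prod.snd) d)) =
      F.obj (O.entry (L.map Prod.snd) d) ◁
          tensShuffle (fun q : List C × C => F.obj (O.entry q.1 q.2))
            (fun q => tens (fun c => F.obj (A.obj c)) q.1) L ≫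
        (α_ _ _ _).inv ≫
        ((F.obj (O.entry (L.map Prod.snd) d) ◁
              tensLax F (fun q : List C × C => O.entry q.1 q.2) L ≫
            μ F _ _ ≫ F.map (O.gamma L d)) ⊗ₘ
          tensFlatten (fun c => F.obj (A.obj c)) Prod.fst L) ≫
        (F.obj (O.entry (L.flatMap Prod.fst) d) ◁ tensLax F A.obj (L.flatMap Prod.fst) ≫
          μ F _ _ ≫ F.map (A.act (L.flatMap Prod.fst) d)) := by
  have key := lax_assoc_aux F L (fun q : List C × C => A.act q.1 q.2)
    (O.entry (L.map Prod.snd) d ◁ tensReindex Prod.snd A.obj L ≫ A.act (L.map Prod.snd) d)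
    (O.gamma L d) (tensFlatten A.obj Prod.fst L) _ (A.assoc L d)
    (fun q => tensLax F A.obj q.1) (tensLax F A.obj (L.flatMap Prod.fst)) _
    (tensLax_flatten F A.obj Prod.fst L)
  refine Eq.trans ?_ key
  exact congrArg (fun x => _ ≫ x)
    (lax_whiskerLeft_aux F _ _ _ _ _ (tensLax_reindex F Prod.snd A.obj L))

/-- The algebra over the image operad obtained by applying a lax symmetric monoidal functor to
an algebra. -/
def mapObj (F : V ⥤ W) [F.LaxBraided] {O : ColoredOperad C V} (A : O.Algebra) :
    (O.map F).Algebra where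
  obj c := F.obj (A.obj c)
  act c d := F.obj (O.entry c d) ◁ tensLax F A.obj c ≫ μ F _ _ ≫ F.map (A.act c d)
  assoc L d := map_assoc F A L d
  unit c := by
    have h := lax_leftUnit_aux F (O.one c) (A.act [c] c) (𝟙 _)
      ((congrArg (fun x => _ ≫ x) (Category.comp_id _)).trans (A.unit c))
    rw [F.map_id, Category.comp_id] at h
    exact h
  equivariant {c c'} p d := by
    refine (lax_whiskerRight_aux F (O.seq.act p d) (tensLax F A.obj c) (A.act c d)).trans ?_
    rw [A.equivariant p d]
    exact (lax_whiskerLeft_aux F _ _ _ _ _ (tensLax_perm F A.obj p)).symm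

/-- The functor on algebras induced by a lax symmetric monoidal functor. -/
def map (F : V ⥤ W) [F.LaxBraided] (O : ColoredOperad C V) :
    O.Algebra ⥤ (O.map F).Algebra where
  obj A := mapObj F A
  map {A B} f :=
    { hom := fun c => F.map (f.hom c)
      act_hom := fun c d => by
        refine (lax_comp_aux F (tensLax F A.obj c) (A.act c d) (f.hom d)).trans ?_
        rw [f.act_hom c d]
        exact (lax_whiskerLeft_aux F _ _ _ _ _ (tensLax_map F f.hom c)).symm }
  map_id A := Algebra.Hom.ext (funext fun c => F.map_id (A.obj c))
  map_comp f g := Algebra.Hom.ext (funext fun c => F.map_comp (f.hom c) (g.hom c))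

end Algebra

/-- A morphism of colored operads with the same set of colors (the identity on colors). -/
structure OperadHom (O P : ColoredOperad C V) where
  hom : ∀ (c : List C) (d : C), O.entry c d ⟶ P.entry c d
  hom_act : ∀ {c c' : List C} (p : PermWord c c') (d : C),
    O.seq.act p d ≫ hom c d = hom c' d ≫ P.seq.act p d
  hom_gamma : ∀ (L : List (List C × C)) (d : C),
    (hom (L.map Prod.snd) d ⊗ₘ tensMap (fun q : List C × C => hom q.1 q.2) L) ≫ P.gamma L d =
      O.gamma L d ≫ hom (L.flatMap Prod.fst) d
  hom_one : ∀ c : C, O.one c ≫ hom [c] c = P.one c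

namespace Algebra

variable {O P : ColoredOperad C V}

/-- Restriction of algebras along a morphism of colored operads. -/
def restrictObj (φ : OperadHom O P) (A : P.Algebra) : O.Algebra where
  obj := A.obj
  act c d := φ.hom c d ▷ tens A.obj c ≫ A.act c d
  assoc L d := by
    have h := A.assoc L d
    have h2 := tensShuffle_natural (fun q : List C × C => φ.hom q.1 q.2)
      (fun q => 𝟙 (tens A.obj q.1)) L
    rw [tensMap_id] at h2
    have h3 := φ.hom_gamma L d
    rw [tensMap_comp, MonoidalCategory.whiskerLeft_comp_assoc, whisker_exchange_assoc,
      whisker_exchange_assoc, h]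
    simp only [← id_tensorHom, ← tensorHom_id] at h2 h3 ⊢
    simp only [tensorHom_comp_tensorHom_assoc, Category.id_comp, Category.comp_id]
    rw [h2, ← Category.id_comp (φ.hom (L.map Prod.snd) d), ← tensorHom_comp_tensorHom_assoc,
      associator_inv_naturality_assoc, tensorHom_comp_tensorHom_assoc, h3, Category.id_comp]
  unit c := by
    show O.one c ▷ tens A.obj [c] ≫ φ.hom [c] c ▷ tens A.obj [c] ≫ A.act [c] c = _
    rw [← comp_whiskerRight_assoc, φ.hom_one]
    exact A.unit c
  equivariant {c c'} p d := by
    rw [← comp_whiskerRight_assoc, φ.hom_act, comp_whiskerRight_assoc, A.equivariant,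
      whisker_exchange_assoc]

/-- The restriction functor on algebras along a morphism of colored operads. -/
def restrict (φ : OperadHom O P) : P.Algebra ⥤ O.Algebra where
  obj A := restrictObj φ A
  map {A B} f :=
    { hom := f.hom
      act_hom := fun c d => by
        show (φ.hom c d ▷ tens A.obj c ≫ A.act c d) ≫ f.hom d =
          O.entry c d ◁ tensMap f.hom c ≫ φ.hom c d ▷ tens B.obj c ≫ B.act c d
        rw [Category.assoc, f.act_hom, whisker_exchange_assoc] }
  map_id _ := rfl
  map_comp _ _ := rfl

end Algebra

section Unit

variable {L : V ⥤ W} [L.LaxBraided] {E : W ⥤ V} [E.LaxBraided] 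
  (η : ∀ X : V, X ⟶ E.obj (L.obj X))

theorem tensLax_unit_comp (hε : η (𝟙_ V) = ε E ≫ E.map (ε L))
  (hμ : ∀ X Y : V, (η X ⊗ₘ η Y) ≫ μ E (L.obj X) (L.obj Y) ≫ E.map (μ L X Y) =
    η (X ⊗ Y)) {ι : Type w'} (X : ι → V) : ∀ l : List ι,
    tensMap (fun i => η (X i)) l ≫ tensLax E (fun i => L.obj (X i)) l ≫
      E.map (tensLax L X l) = η (tens X l)
  | [] => (Category.id_comp _).trans hε.symm
  | i :: l => by
      show (η (X i) ⊗ₘ tensMap (fun i => η (X i)) l) ≫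
        (E.obj (L.obj (X i)) ◁ tensLax E (fun i => L.obj (X i)) l ≫
          μ E (L.obj (X i)) (tens (fun i => L.obj (X i)) l)) ≫
        E.map (L.obj (X i) ◁ tensLax L X l ≫ μ L (X i) (tens X l)) =
          η (X i ⊗ tens X l)
      rw [← hμ, E.map_comp, Category.assoc, ← μ_natural_right_assoc, ← id_tensorHom,
        ← id_tensorHom, tensorHom_comp_tensorHom_assoc, tensorHom_comp_tensorHom_assoc,
        Category.assoc, Category.assoc, tensLax_unit_comp hε hμ X l]
      simp

/-- The morphism from an operad to its image under a composite of two lax symmetric monoidal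
functors that is induced by a monoidal natural transformation. -/
def unitHom (hη : ∀ {X Y : V} (f : X ⟶ Y), f ≫ η Y = η X ≫ E.map (L.map f))
    (hε : η (𝟙_ V) = ε E ≫ E.map (ε L))
    (hμ : ∀ X Y : V, (η X ⊗ₘ η Y) ≫ μ E (L.obj X) (L.obj Y) ≫ E.map (μ L X Y) =
      η (X ⊗ Y)) (O : ColoredOperad C V) : OperadHom O ((O.map L).map E) where
  hom c d := η (O.entry c d)
  hom_act p d := hη (O.seq.act p d)
  hom_gamma l d := by
    have h := tensLax_unit_comp η hε hμ (fun q : List C × C => O.entry q.1 q.2) l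
    have n := hη (O.gamma l d)
    refine Eq.trans ?_ n.symm
    show (η (O.entry (l.map Prod.snd) d) ⊗ₘ
        tensMap (fun q : List C × C => η (O.entry q.1 q.2)) l) ≫
      (E.obj (L.obj (O.entry (l.map Prod.snd) d)) ◁
        tensLax E (fun q : List C × C => L.obj (O.entry q.1 q.2)) l ≫ μ E _ _ ≫
        E.map (L.obj (O.entry (l.map Prod.snd) d) ◁
          tensLax L (fun q : List C × C => O.entry q.1 q.2) l ≫ μ L _ _ ≫
          L.map (O.gamma l d))) = η (O.entry (l.map Prod.snd) d ⊗
        tens (fun q : List C × C => O.entry q.1 q.2) l) ≫ E.map (L.map (O.gamma l d))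
    rw [← hμ, E.map_comp, E.map_comp, ← μ_natural_right_assoc, ← id_tensorHom, ← id_tensorHom,
      tensorHom_comp_tensorHom_assoc, tensorHom_comp_tensorHom_assoc, Category.assoc, Category.assoc, h]
    simp
  hom_one c := by
    have n := hη (O.one c)
    refine n.trans ?_
    show η (𝟙_ V) ≫ E.map (L.map (O.one c)) = ε E ≫ E.map (ε L ≫ L.map (O.one c))
    rw [hε, E.map_comp, Category.assoc]

end Unit

end ColoredOperad

end AlgebraMap

section SmithIdealDefs

variable {M : Type u} [Category.{v} M] [MonoidalCategory M] [SymmetricCategory M] {C : Type w}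

/-- The category of maps of `O`-algebras, as the category of algebras over the image `O^⊗` of `O`
under `L₀` in the arrow category with the entrywise tensor product. -/
abbrev AlgebraMap (O : ColoredOperad C M) := (O.map (idArrow M)).Algebra

/-- The underlying family of arrows of a map of `O`-algebras. -/
abbrev AlgebraMap.forget (O : ColoredOperad C M) : AlgebraMap O ⥤ (C → TensorArrow M) :=
  ColoredOperad.Algebra.forget (O.map (idArrow M))

/-- The domain of a map of `O`-algebras, as an `O`-algebra. -/
def domainAlgebra (O : ColoredOperad C M) : AlgebraMap O ⥤ O.Algebra :=
  ColoredOperad.Algebra.map (domain M) (O.map (idArrow M)) ⋙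
    ColoredOperad.Algebra.restrict (ColoredOperad.unitHom (L := idArrow M) (E := domain M)
      (fun X => 𝟙 X) (fun _ => (Category.comp_id _).trans (Category.id_comp _).symm)
      (Category.id_comp _).symm
      (fun X Y => by
        have h : (𝟙 X ⊗ₘ 𝟙 Y) ≫ 𝟙 (X ⊗ Y) ≫ 𝟙 (X ⊗ Y) = 𝟙 (X ⊗ Y) := by simp
        exact h) O)

variable [HasFiniteColimits M] [∀ W : M, PreservesFiniteColimits (tensorLeft W)]

/-- The category of Smith `O`-ideals: algebras over the image `O^□` of `O` under `L₁` in the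
arrow category with the pushout product. -/
abbrev SmithIdeal (O : ColoredOperad C M) := (O.map (initialArrow M)).Algebra

/-- The underlying family of arrows of a Smith `O`-ideal. -/
noncomputable abbrev SmithIdeal.forget (O : ColoredOperad C M) :
    SmithIdeal O ⥤ (C → PushoutArrow M) :=
  ColoredOperad.Algebra.forget (O.map (initialArrow M))

/-- The codomain of a Smith `O`-ideal, as an `O`-algebra. -/
noncomputable def ambientAlgebra (O : ColoredOperad C M) : SmithIdeal O ⥤ O.Algebra :=
  ColoredOperad.Algebra.map (codomain M) (O.map (initialArrow M)) ⋙
    ColoredOperad.Algebra.restrict (ColoredOperad.unitHom (L := initialArrow M) (E := codomain M)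
      (fun X => 𝟙 X) (fun _ => (Category.comp_id _).trans (Category.id_comp _).symm)
      (Category.id_comp _).symm
      (fun X Y => by
        have h : (𝟙 X ⊗ₘ 𝟙 Y) ≫ 𝟙 (X ⊗ Y) ≫ 𝟙 (X ⊗ Y) = 𝟙 (X ⊗ Y) := by simp
        exact h) O)

end SmithIdealDefs
end SmithIdeals

open SmithIdeals

/-! The adjunction `hoveyAdj` is monoidal: both `hoveyCoker` and `hoveyKer` are lax symmetric
monoidal, and its unit and counit respect the lax structures. A lax symmetric monoidal functor
carries algebras over an operad to algebras over the image operad. The two operads here match up,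
because `coker (⊥ ⟶ X)` is isomorphic to the identity arrow of `X`; thus `O^⊗` is entrywise
isomorphic to the image of `O^□` under coker. Restricting along this comparison `O^⊗ ⟶ coker O^□`,
and along its mate `O^□ ⟶ ker O^⊗`, brings the image algebras back to the required operads. The unit
and counit of Hovey's adjunction are algebra maps in this setting, and the triangle identities are
inherited color by color. This formal part is `transportAdj`.

The mathematical input is the interplay of the two tensor products. Since tensoring preserves
cokernels, `coker f ⊗ coker g` is a cokernel of the pushout product of `f` and `g`
(`exists_cokernel_tensor_desc`, together with `epi_tensorHom` and `ppHom_tensorHom_eq_zero`); this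
gives the multiplication of coker. Dually, the pushout product of two kernel inclusions is
annihilated by the tensor product of the original maps (`ppHom_tensorHom_eq_zero`), which gives the
multiplication of ker.

All coherence conditions are cheap for one reason. A commutative square out of an epimorphism is
determined by its map on domains, and a square into a monomorphism by its map on codomains
(`arrow_hom_ext_left`, `arrow_hom_ext_right`). The domain of coker is the `codomain` functor and the
codomain of ker is the `domain` functor, each with identities as structure maps, so every condition
reduces to one that is already known in `M`.

The same observation identifies the algebra structures: taking domains after coker, or codomains
after ker, composes only identities with the original action, so the equalities of functors hold
strictly (`cokerAlgebra_domainAlgebra`, `kerAlgebra_ambientAlgebra`). -/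

namespace SmithIdeals

/-! ### Monoidal adjunctions and iterated tensor products. -/

section LaxAdjunction

open Functor.LaxMonoidal

universe v₁ v₂ u₁ u₂

variable {V : Type u₁} [Category.{v₁} V] [MonoidalCategory V]
  {W : Type u₂} [Category.{v₂} W] [MonoidalCategory W]
  {L : V ⥤ W} [L.LaxMonoidal] {E : W ⥤ V} [E.LaxMonoidal]

/-- Monoidality of the counit for two factors and for the unit object propagates to any number of
factors by induction on the list. It is the counterpart of `tensLax_unit_comp`. -/
theorem tensLax_counit_comp (e : ∀ Y : W, L.obj (E.obj Y) ⟶ Y)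
    (hε : ε L ≫ L.map (ε E) ≫ e (𝟙_ W) = 𝟙 _)
    (hμ : ∀ X Y : W, μ L (E.obj X) (E.obj Y) ≫ L.map (μ E X Y) ≫ e (X ⊗ Y) = e X ⊗ₘ e Y)
    (he : ∀ {X Y : W} (f : X ⟶ Y), L.map (E.map f) ≫ e Y = e X ≫ f)
    {ι : Type w} (X : ι → W) : ∀ l : List ι,
    tensLax L (fun i => E.obj (X i)) l ≫ L.map (tensLax E X l) ≫ e (tens X l) =
      tensMap (fun i => e (X i)) l
  | [] => hε
  | i :: l => by
      show (L.obj (E.obj (X i)) ◁ tensLax L (fun i => E.obj (X i)) l ≫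
          μ L (E.obj (X i)) (tens (fun i => E.obj (X i)) l)) ≫
        L.map (E.obj (X i) ◁ tensLax E X l ≫ μ E (X i) (tens X l)) ≫ e (X i ⊗ tens X l) =
          e (X i) ⊗ₘ tensMap (fun i => e (X i)) l
      -- Naturality moves the image of the inner `tensLax E` in front of `μ L`; then `hμ` splits the
      -- counit into a tensor product, and the induction hypothesis treats the second factor.
      rw [L.map_comp, Category.assoc, Category.assoc, ← μ_natural_right_assoc, hμ,
        ← id_tensorHom, ← id_tensorHom, tensorHom_comp_tensorHom, tensorHom_comp_tensorHom,
        tensLax_counit_comp e hε hμ he X l, Category.id_comp, Category.id_comp]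

/-- This is what makes the unit a map of algebras: `a` is the action on an algebra, and the right
side is its action transported along `L` and then along `E`. Naturality moves `η` in front of `a`,
monoidality splits it over `P ⊗ T`, and `h` and `hT` factor the two pieces through the operad
comparison and the iterated tensor products. -/
theorem act_unit_aux (η : ∀ X : V, X ⟶ E.obj (L.obj X))
    (hη : ∀ {X Y : V} (f : X ⟶ Y), f ≫ η Y = η X ≫ E.map (L.map f))
    (hμ : ∀ X Y : V, (η X ⊗ₘ η Y) ≫ μ E (L.obj X) (L.obj Y) ≫ E.map (μ L X Y) = η (X ⊗ Y))
    {P : V} {Q : W} (φ : P ⟶ E.obj Q) (ψ : Q ⟶ L.obj P) (h : φ ≫ E.map ψ = η P)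
    {T T' D : V} {U : W} (a : P ⊗ T ⟶ D) (m : T ⟶ T') (s : T' ⟶ E.obj U) (t : U ⟶ L.obj T)
    (hT : m ≫ s ≫ E.map t = η T) :
    a ≫ η D = P ◁ m ≫ φ ▷ T' ≫ E.obj Q ◁ s ≫ μ E Q U ≫
      E.map (ψ ▷ U ≫ L.obj P ◁ t ≫ μ L P T ≫ L.map a) := by
  rw [hη, ← hμ]
  simp only [E.map_comp, Category.assoc]
  rw [← μ_natural_left_assoc, ← μ_natural_right_assoc, ← h, ← hT]
  simp only [← id_tensorHom, ← tensorHom_id, tensorHom_comp_tensorHom_assoc,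
    Category.id_comp, Category.comp_id]

/-- The counterpart of `act_unit_aux` for the counit: naturality and monoidality turn `e` into a
tensor product in front of `a`. Its operad factor cancels by `h`, and its algebra factor is `m` by
`hT`. -/
theorem act_counit_aux (e : ∀ Y : W, L.obj (E.obj Y) ⟶ Y)
    (he : ∀ {X Y : W} (f : X ⟶ Y), L.map (E.map f) ≫ e Y = e X ≫ f)
    (hμ : ∀ X Y : W, μ L (E.obj X) (E.obj Y) ≫ L.map (μ E X Y) ≫ e (X ⊗ Y) = e X ⊗ₘ e Y)
    {P : V} {Q : W} (φ : P ⟶ E.obj Q) (ψ : Q ⟶ L.obj P) (h : ψ ≫ L.map φ ≫ e Q = 𝟙 Q)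
    {T D T' : W} {U : V} (a : Q ⊗ T ⟶ D) (t : T' ⟶ L.obj U) (s : U ⟶ E.obj T) (m : T' ⟶ T)
    (hT : t ≫ L.map s ≫ e T = m) :
    (ψ ▷ T' ≫ L.obj P ◁ t ≫ μ L P U ≫ L.map (φ ▷ U ≫ E.obj Q ◁ s ≫ μ E Q T ≫ E.map a)) ≫ e D =
      Q ◁ m ≫ a := by
  simp only [L.map_comp, Category.assoc]
  rw [he, ← μ_natural_left_assoc, ← μ_natural_right_assoc, reassoc_of% (hμ Q T), ← hT]
  simp only [← id_tensorHom, ← tensorHom_id, tensorHom_comp_tensorHom_assoc,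
    Category.id_comp]
  rw [h]

end LaxAdjunction

/-! ### Comparison of images of an operad under different lax functors. -/

namespace ColoredOperad

open Functor.LaxMonoidal

universe v₁ v₂ v₃ u₁ u₂ u₃

section Compare

variable {C : Type w} {V : Type u₁} [Category.{v₁} V] [MonoidalCategory V] [SymmetricCategory V]
  {W : Type u₂} [Category.{v₂} W] [MonoidalCategory W] [SymmetricCategory W]
  {U : Type u₃} [Category.{v₃} U] [MonoidalCategory U] [SymmetricCategory U]
  {F : V ⥤ U} [F.LaxBraided] {L : V ⥤ W} [L.LaxBraided] {E : W ⥤ U} [E.LaxBraided]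
  (η : ∀ X : V, F.obj X ⟶ E.obj (L.obj X))

/-- A version of `tensLax_unit_comp` with a lax functor `F` in place of the identity. It serves
twice: for the operad maps between `O^⊗` and `O^□`, and, with identities as `η`, to identify the
domain of coker and the codomain of ker as lax functors. -/
theorem tensLax_compare (hε : ε F ≫ η (𝟙_ V) = ε E ≫ E.map (ε L))
    (hμ : ∀ X Y : V, (η X ⊗ₘ η Y) ≫ μ E (L.obj X) (L.obj Y) ≫ E.map (μ L X Y) =
      μ F X Y ≫ η (X ⊗ Y))
    {ι : Type w'} (X : ι → V) : ∀ l : List ι,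
    tensMap (fun i => η (X i)) l ≫ tensLax E (fun i => L.obj (X i)) l ≫
      E.map (tensLax L X l) = tensLax F X l ≫ η (tens X l)
  | [] => (Category.id_comp _).trans hε.symm
  | i :: l => by
      show (η (X i) ⊗ₘ tensMap (fun i => η (X i)) l) ≫
        (E.obj (L.obj (X i)) ◁ tensLax E (fun i => L.obj (X i)) l ≫
          μ E (L.obj (X i)) (tens (fun i => L.obj (X i)) l)) ≫
        E.map (L.obj (X i) ◁ tensLax L X l ≫ μ L (X i) (tens X l)) =
          (F.obj (X i) ◁ tensLax F X l ≫ μ F (X i) (tens X l)) ≫ η (X i ⊗ tens X l)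
      rw [Category.assoc (F.obj (X i) ◁ _), ← hμ, E.map_comp, Category.assoc,
        ← μ_natural_right_assoc, ← id_tensorHom,
        ← id_tensorHom, ← id_tensorHom, tensorHom_comp_tensorHom_assoc,
        tensorHom_comp_tensorHom_assoc, tensorHom_comp_tensorHom_assoc,
        Category.assoc, Category.assoc, tensLax_compare hε hμ X l]
      simp

/-- The morphism from the image of an operad under `F` to its image under the composite of `L`
and `E` that is induced by a monoidal natural transformation. -/
def compareHom (hη : ∀ {X Y : V} (f : X ⟶ Y), F.map f ≫ η Y = η X ≫ E.map (L.map f))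
    (hε : ε F ≫ η (𝟙_ V) = ε E ≫ E.map (ε L))
    (hμ : ∀ X Y : V, (η X ⊗ₘ η Y) ≫ μ E (L.obj X) (L.obj Y) ≫ E.map (μ L X Y) =
      μ F X Y ≫ η (X ⊗ Y)) (O : ColoredOperad C V) :
    OperadHom (O.map F) ((O.map L).map E) where
  hom c d := η (O.entry c d)
  hom_act p d := hη (O.seq.act p d)
  hom_gamma l d := by
    have h := tensLax_compare η hε hμ (fun q : List C × C => O.entry q.1 q.2) l
    have n := hη (O.gamma l d)
    show (η (O.entry (l.map Prod.snd) d) ⊗ₘ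
        tensMap (fun q : List C × C => η (O.entry q.1 q.2)) l) ≫
      (E.obj (L.obj (O.entry (l.map Prod.snd) d)) ◁
        tensLax E (fun q : List C × C => L.obj (O.entry q.1 q.2)) l ≫ μ E _ _ ≫
        E.map (L.obj (O.entry (l.map Prod.snd) d) ◁
          tensLax L (fun q : List C × C => O.entry q.1 q.2) l ≫ μ L _ _ ≫
          L.map (O.gamma l d))) =
      (F.obj (O.entry (l.map Prod.snd) d) ◁
          tensLax F (fun q : List C × C => O.entry q.1 q.2) l ≫ μ F _ _ ≫ F.map (O.gamma l d)) ≫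
        η (O.entry (l.flatMap Prod.fst) d)
    -- Naturality at `O.gamma` moves `η` to the left of it, and `hμ` splits `η` into its value on
    -- the outer operation and its value on the inner ones, to which `h` applies.
    rw [Category.assoc (F.obj _ ◁ _), Category.assoc (μ F _ _), n, ← reassoc_of% hμ,
      E.map_comp, E.map_comp, ← μ_natural_right_assoc,
      ← id_tensorHom, ← id_tensorHom, ← id_tensorHom,
      tensorHom_comp_tensorHom_assoc, tensorHom_comp_tensorHom_assoc,
      tensorHom_comp_tensorHom_assoc, Category.assoc, Category.assoc, h]
    simp
  hom_one c := by
    have n := hη (O.one c)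
    show (ε F ≫ F.map (O.one c)) ≫ η _ = ε E ≫ E.map (ε L ≫ L.map (O.one c))
    rw [Category.assoc, n, E.map_comp, reassoc_of% hε]

end Compare

/-! ### Lifting an adjunction to categories of algebras. -/

namespace Algebra

variable {C : Type w} {V : Type u₁} [Category.{v₁} V] [MonoidalCategory V] [SymmetricCategory V]
  {W : Type u₂} [Category.{v₂} W] [MonoidalCategory W] [SymmetricCategory W]

/-- The functor on algebras induced by a lax symmetric monoidal functor `F` and a morphism from
an operad to the image of another one under `F`. -/
def transport (F : V ⥤ W) [F.LaxBraided] {O : ColoredOperad C V} {P : ColoredOperad C W}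
    (φ : OperadHom P (O.map F)) : O.Algebra ⥤ P.Algebra :=
  map F O ⋙ restrict φ

/-- A monoidal adjunction between lax symmetric monoidal functors lifts to categories of algebras
over operads that are related by a pair of mutually conjugate morphisms. -/
def transportAdj {L : V ⥤ W} [L.LaxBraided] {E : W ⥤ V} [E.LaxBraided] (adj : L ⊣ E)
    (unit_ε : adj.unit.app (𝟙_ V) = ε E ≫ E.map (ε L))
    (unit_μ : ∀ X Y : V, (adj.unit.app X ⊗ₘ adj.unit.app Y) ≫ μ E (L.obj X) (L.obj Y) ≫
      E.map (μ L X Y) = adj.unit.app (X ⊗ Y))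
    (counit_ε : ε L ≫ L.map (ε E) ≫ adj.counit.app (𝟙_ W) = 𝟙 _)
    (counit_μ : ∀ X Y : W, μ L (E.obj X) (E.obj Y) ≫ L.map (μ E X Y) ≫ adj.counit.app (X ⊗ Y) =
      adj.counit.app X ⊗ₘ adj.counit.app Y)
    {P : ColoredOperad C V} {Q : ColoredOperad C W}
    (φ : OperadHom P (Q.map E)) (ψ : OperadHom Q (P.map L))
    -- Under the adjunction, `hφ` and `hψ` together say that `ψ.hom c d` is inverse to the adjunct
    -- `L (P c d) ⟶ Q c d` of `φ.hom c d`: the first corresponds to the composite being the identity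
    -- of `L (P c d)`, the second to that of `Q c d`.
    (hφ : ∀ (c : List C) (d : C), φ.hom c d ≫ E.map (ψ.hom c d) = adj.unit.app (P.entry c d))
    (hψ : ∀ (c : List C) (d : C),
      ψ.hom c d ≫ L.map (φ.hom c d) ≫ adj.counit.app (Q.entry c d) = 𝟙 _) :
    transport L ψ ⊣ transport E φ where
  unit :=
    { app A :=
        { hom c := adj.unit.app (A.obj c)
          act_hom c d := act_unit_aux (fun X => adj.unit.app X) (fun f => adj.unit.naturality f)
            unit_μ (φ.hom c d) (ψ.hom c d) (hφ c d) (A.act c d) _ _ _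
            (tensLax_unit_comp (fun X => adj.unit.app X) unit_ε unit_μ A.obj c) }
      naturality _ _ f := Hom.ext (funext fun c => adj.unit.naturality (f.hom c)) }
  counit :=
    { app B :=
        { hom c := adj.counit.app (B.obj c)
          act_hom c d := act_counit_aux (fun X => adj.counit.app X)
            (fun f => adj.counit.naturality f)
            counit_μ (φ.hom c d) (ψ.hom c d) (hψ c d) (B.act c d) _ _ _
            (tensLax_counit_comp (fun X => adj.counit.app X) counit_ε counit_μ
              (fun f => adj.counit.naturality f) B.obj c) }
      naturality _ _ f := Hom.ext (funext fun c => adj.counit.naturality (f.hom c)) }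
  -- Morphisms of algebras are determined by their components, and transport does not change the
  -- underlying objects beyond applying `L` or `E`; the triangle identities are therefore those of
  -- `adj` in each color.
  left_triangle_components A :=
    Hom.ext (funext fun c => adj.left_triangle_components (A.obj c))
  right_triangle_components B :=
    Hom.ext (funext fun c => adj.right_triangle_components (B.obj c))

/-- The remaining fields are propositions. Heterogeneous equality is needed because the type of
`act` depends on `obj`. -/
theorem ext_obj_act {O : ColoredOperad C V} {A B : O.Algebra} (h : A.obj = B.obj)
    (h' : A.act ≍ B.act) : A = B := by
  cases A; cases B; cases h; cases h'; rfl

theorem eqToHom_hom {O : ColoredOperad C V} {A B : O.Algebra} (h : A = B) (c : C) :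
    Algebra.Hom.hom (eqToHom h) c = eqToHom (congrArg (fun A : O.Algebra => A.obj c) h) := by
  subst h
  rfl

/-- Reduces equality of functors into algebras to a componentwise check in `V`. This is useful when
the underlying objects agree definitionally: the transports are then identities. -/
theorem functor_ext {J : Type u'} [Category.{v'} J] {O : ColoredOperad C V} {F G : J ⥤ O.Algebra}
    (h : ∀ A, F.obj A = G.obj A)
    (h' : ∀ {A B : J} (f : A ⟶ B) (c : C), Algebra.Hom.hom (F.map f) c =
      eqToHom (congrArg (fun A : O.Algebra => A.obj c) (h A)) ≫ Algebra.Hom.hom (G.map f) c ≫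
        eqToHom (congrArg (fun A : O.Algebra => A.obj c) (h B).symm)) : F = G :=
  CategoryTheory.Functor.ext h fun A B f => Algebra.Hom.ext (funext fun c => by
    rw [h', ← eqToHom_hom (h A), ← eqToHom_hom (h B).symm]
    rfl)

end Algebra
end ColoredOperad

/-! ### Tensor products of epimorphisms. -/

section TensorEpi

variable {M : Type u} [Category.{v} M] [MonoidalCategory M] [SymmetricCategory M]
  [∀ W : M, PreservesFiniteColimits (tensorLeft W)]

/-- Being an epimorphism is a pushout condition, so it survives any functor that preserves finite
colimits. -/
theorem epi_whiskerLeft (W : M) {A B : M} {f : A ⟶ B} (_ : Epi f) : Epi (W ◁ f) :=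
  inferInstanceAs (Epi ((tensorLeft W).map f))

theorem epi_whiskerRight {A B : M} {f : A ⟶ B} (hf : Epi f) (W : M) : Epi (f ▷ W) := by
  have := epi_whiskerLeft W hf
  have h : f ▷ W = (β_ A W).hom ≫ W ◁ f ≫ (β_ W B).hom := by simp
  rw [h]
  infer_instance

theorem epi_tensorHom {A B A' B' : M} {f : A ⟶ B} {g : A' ⟶ B'} (hf : Epi f) (hg : Epi g) :
    Epi (f ⊗ₘ g) := by
  have := epi_whiskerRight hf A'
  have := epi_whiskerLeft B hg
  rw [MonoidalCategory.tensorHom_def]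
  infer_instance

end TensorEpi

/-! ### Zero morphisms, cokernels and the pushout product. -/

section CornerZero

variable {M : Type u} [Category.{v} M] [MonoidalCategory M] [SymmetricCategory M]
  [HasFiniteColimits M] [∀ W : M, PreservesFiniteColimits (tensorLeft W)] [HasZeroMorphisms M]

open PushoutProductArrow

/-- A zero map factors through the initial object, and `W ⊗ ⊥` is again initial, so the second
factor after tensoring can only be zero. -/
theorem whiskerLeft_zero (W A B : M) : W ◁ (0 : A ⟶ B) = 0 := by
  have h : (0 : A ⟶ B) = (0 : A ⟶ ⊥_ M) ≫ initial.to B := by simp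
  rw [h, MonoidalCategory.whiskerLeft_comp, tensor_initial_hom_ext (W ◁ initial.to B) 0,
    comp_zero]

theorem zero_whiskerRight (W A B : M) : (0 : A ⟶ B) ▷ W = 0 := by
  have h : (0 : A ⟶ B) = (0 : A ⟶ ⊥_ M) ≫ initial.to B := by simp
  rw [h, comp_whiskerRight, initial_tensor_hom_ext (initial.to B ▷ W) 0, comp_zero]

theorem zero_tensorHom {A B A' B' : M} (g : A' ⟶ B') : (0 : A ⟶ B) ⊗ₘ g = 0 := by
  rw [MonoidalCategory.tensorHom_def, zero_whiskerRight, zero_comp]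

theorem tensorHom_zero {A B A' B' : M} (f : A ⟶ B) : f ⊗ₘ (0 : A' ⟶ B') = 0 := by
  rw [MonoidalCategory.tensorHom_def, whiskerLeft_zero, comp_zero]

instance (W : M) : (tensorLeft W).PreservesZeroMorphisms where
  map_zero A B := whiskerLeft_zero W A B

instance (W : M) : (tensorRight W).PreservesZeroMorphisms where
  map_zero A B := zero_whiskerRight W A B

/-- The pushout product of two maps composes to zero with the tensor product of two maps that
annihilate them. -/
theorem ppHom_tensorHom_eq_zero {A B D A' B' D' : M} {f : A ⟶ B} {g : A' ⟶ B'} {p : B ⟶ D}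
    {q : B' ⟶ D'} (hp : f ≫ p = 0) (hq : g ≫ q = 0) : ppHom f g ≫ (p ⊗ₘ q) = 0 := by
  apply corner_hom_ext
  · rw [reassoc_of% @inl_ppHom, ← id_tensorHom, tensorHom_comp_tensorHom, hq, tensorHom_zero,
      comp_zero]
  · rw [reassoc_of% @inr_ppHom, ← tensorHom_id, tensorHom_comp_tensorHom, hp, zero_tensorHom,
      comp_zero]

section Cokernel

variable {A B A' B' : M} (f : A ⟶ B) (g : A' ⟶ B')

/-- Tensoring preserves colimits and zero morphisms, hence cokernels. -/
noncomputable def cokernelWhiskerRight (W : M) :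
    IsColimit (CokernelCofork.ofπ (f := f ▷ W) (cokernel.π f ▷ W)
      (by rw [← comp_whiskerRight, cokernel.condition, zero_whiskerRight])) :=
  CokernelCofork.mapIsColimit _ (cokernelIsCokernel f) (tensorRight W)

noncomputable def cokernelWhiskerLeft (W : M) :
    IsColimit (CokernelCofork.ofπ (f := W ◁ f) (W ◁ cokernel.π f)
      (by rw [← MonoidalCategory.whiskerLeft_comp, cokernel.condition, whiskerLeft_zero])) :=
  CokernelCofork.mapIsColimit _ (cokernelIsCokernel f) (tensorLeft W)

/-- The tensor product of the cokernels of two maps is the cokernel of their pushout product. -/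
theorem exists_cokernel_tensor_desc {Z : M} (k : B ⊗ B' ⟶ Z) (hk : ppHom f g ≫ k = 0) :
    ∃ l : cokernel f ⊗ cokernel g ⟶ Z, (cokernel.π f ⊗ₘ cokernel.π g) ≫ l = k := by
  -- The restrictions of the pushout product to the two summands of its domain are `f ▷ B'` and `B ◁
  -- g`. The cokernel of the first is taken, then the remaining relation is imposed to pass to
  -- `coker f ⊗ coker g`.
  have h₁ : f ▷ B' ≫ k = 0 := by rw [← inr_ppHom f g, Category.assoc, hk, comp_zero]
  have h₂ : B ◁ g ≫ k = 0 := by rw [← inl_ppHom f g, Category.assoc, hk, comp_zero]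
  obtain ⟨m, hm⟩ := CokernelCofork.IsColimit.desc' (cokernelWhiskerRight f B') k h₁
  replace hm : cokernel.π f ▷ B' ≫ m = k := hm
  have h₃ : cokernel f ◁ g ≫ m = 0 := by
    -- The vanishing can be tested after the epimorphism `cokernel.π f ▷ A'`; the interchange law
    -- then turns the composite into `B ◁ g ≫ k`.
    have := epi_whiskerRight (f := cokernel.π f) inferInstance A'
    rw [← cancel_epi (cokernel.π f ▷ A'), ← whisker_exchange_assoc, hm, h₂, comp_zero]
  obtain ⟨l, hl⟩ := CokernelCofork.IsColimit.desc' (cokernelWhiskerLeft g (cokernel f)) m h₃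
  replace hl : cokernel f ◁ cokernel.π g ≫ l = m := hl
  exact ⟨l, by rw [MonoidalCategory.tensorHom_def, Category.assoc, hl, hm]⟩

noncomputable def cokernelTensorDesc {Z : M} (k : B ⊗ B' ⟶ Z) (hk : ppHom f g ≫ k = 0) :
    cokernel f ⊗ cokernel g ⟶ Z :=
  (exists_cokernel_tensor_desc f g k hk).choose

theorem tensorHom_cokernelTensorDesc {Z : M} (k : B ⊗ B' ⟶ Z) (hk : ppHom f g ≫ k = 0) :
    (cokernel.π f ⊗ₘ cokernel.π g) ≫ cokernelTensorDesc f g k hk = k :=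
  (exists_cokernel_tensor_desc f g k hk).choose_spec

end Cokernel

end CornerZero

/-! ### Squares determined by one leg. -/

section ArrowExt

variable {M : Type u} [Category.{v} M]

/-- Commutativity of the square fixes the right leg after precomposition with `f.hom`, which can be
cancelled. With its dual below, this disposes of the coherence conditions for coker and ker without
computing any map out of a cokernel or into a kernel. -/
theorem arrow_hom_ext_left {f g : Arrow M} {h k : f ⟶ g} (_ : Epi f.hom) (e : h.left = k.left) :
    h = k :=
  arrow_hom_ext e (by rw [← cancel_epi f.hom, ← Arrow.w h, ← Arrow.w k, e])

theorem arrow_hom_ext_right {f g : Arrow M} {h k : f ⟶ g} (_ : Mono g.hom) (e : h.right = k.right) :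
    h = k :=
  arrow_hom_ext (by rw [← cancel_mono g.hom, Arrow.w h, Arrow.w k, e]) e

end ArrowExt

/-! ### Lax symmetric monoidal structures on coker and ker. -/

section HoveyMonoidal

variable {M : Type u} [Category.{v} M] [MonoidalCategory M] [SymmetricCategory M]
  [HasFiniteColimits M] [∀ W : M, PreservesFiniteColimits (tensorLeft W)] [HasZeroMorphisms M]

open PushoutProductArrow

theorem epi_coker (f : Arrow M) : Epi (cokernel.π f.hom) := inferInstance

theorem epi_id (X : M) : Epi (𝟙 X) := inferInstance

/-- The multiplication of coker. It is in fact invertible, since both arrows are cokernels of the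
pushout product, but only this direction is needed for the action on algebras. -/
noncomputable def hoveyCokerMu (f g : Arrow M) :
    Arrow.mk (cokernel.π f.hom ⊗ₘ cokernel.π g.hom) ⟶
      Arrow.mk (cokernel.π (ppHom f.hom g.hom)) :=
  Arrow.homMk (𝟙 (f.right ⊗ g.right))
    (cokernelTensorDesc f.hom g.hom (cokernel.π (ppHom f.hom g.hom)) (cokernel.condition _))
    ((Category.id_comp _).trans (tensorHom_cokernelTensorDesc _ _ _ _).symm)

/-- The squares in the axioms start at tensor products of cokernel projections and identity arrows.
These are epimorphisms, so only domains have to be compared; there coker is the `codomain` functor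
with its identity structure maps, and its axioms apply verbatim. -/
noncomputable instance : (hoveyCoker M).LaxMonoidal where
  ε := Arrow.homMk (f := Arrow.mk (𝟙 (𝟙_ M))) (g := Arrow.mk (cokernel.π (initial.to (𝟙_ M))))
    (𝟙 (𝟙_ M)) (cokernel.π (initial.to (𝟙_ M))) rfl
  μ f g := hoveyCokerMu f g
  μ_natural_left {f _} a g := arrow_hom_ext_left (epi_tensorHom (epi_coker f) (epi_coker g))
    (Functor.LaxMonoidal.μ_natural_left (codomain M) a g)
  μ_natural_right {f _} g a := arrow_hom_ext_left (epi_tensorHom (epi_coker g) (epi_coker f))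
    (Functor.LaxMonoidal.μ_natural_right (codomain M) g a)
  associativity f g h := arrow_hom_ext_left
    (epi_tensorHom (epi_tensorHom (epi_coker f) (epi_coker g)) (epi_coker h))
    (Functor.LaxMonoidal.associativity (codomain M) f g h)
  left_unitality f := arrow_hom_ext_left (epi_tensorHom (epi_id _) (epi_coker f))
    (Functor.LaxMonoidal.left_unitality (codomain M) f)
  right_unitality f := arrow_hom_ext_left (epi_tensorHom (epi_coker f) (epi_id _))
    (Functor.LaxMonoidal.right_unitality (codomain M) f)

noncomputable instance : (hoveyCoker M).LaxBraided where
  braided f g := arrow_hom_ext_left (epi_tensorHom (epi_coker f) (epi_coker g))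
    (Functor.LaxBraided.braided (F := codomain M) f g)

variable [HasKernels M]

theorem mono_ker (f : Arrow M) : Mono (kernel.ι f.hom) := inferInstance

/-- The pushout product of the two kernel inclusions is annihilated by `f.hom ⊗ₘ g.hom`, hence
factors through the kernel of that map. -/
noncomputable def hoveyKerMu (f g : Arrow M) :
    Arrow.mk (ppHom (kernel.ι f.hom) (kernel.ι g.hom)) ⟶ Arrow.mk (kernel.ι (f.hom ⊗ₘ g.hom)) :=
  Arrow.homMk (kernel.lift _ (ppHom (kernel.ι f.hom) (kernel.ι g.hom))
      (ppHom_tensorHom_eq_zero (kernel.condition _) (kernel.condition _)))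
    (𝟙 (f.left ⊗ g.left)) ((kernel.lift_ι _ _ _).trans (Category.comp_id _).symm)

/-- Dual to coker: the squares end in kernel inclusions, which are monomorphisms, so only codomains
have to be compared; there ker is the `domain` functor. -/
noncomputable instance : (hoveyKer M).LaxMonoidal where
  ε := Arrow.homMk (f := Arrow.mk (initial.to (𝟙_ M))) (g := Arrow.mk (kernel.ι (𝟙 (𝟙_ M))))
    (initial.to _) (𝟙 (𝟙_ M)) (initialIsInitial.hom_ext _ _)
  μ f g := hoveyKerMu f g
  μ_natural_left a g := arrow_hom_ext_right (mono_ker _)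
    -- Whiskering for the pushout product is a tensor product with an identity on codomains, whereas
    -- the axioms for `domain` are stated with whiskerings in `M`; `tensorHom_id` and `id_tensorHom`
    -- reconcile the two here and below.
    ((congrArg (fun x => x ≫ _) (tensorHom_id _ _)).trans
      (Functor.LaxMonoidal.μ_natural_left (domain M) a g))
  μ_natural_right g a := arrow_hom_ext_right (mono_ker _)
    ((congrArg (fun x => x ≫ _) (id_tensorHom _ _)).trans
      (Functor.LaxMonoidal.μ_natural_right (domain M) g a))
  associativity f g h := arrow_hom_ext_right (mono_ker _)
    ((congrArg₂ (fun x y => x ≫ _ ≫ y) (tensorHom_id _ _) rfl).trans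
      ((Functor.LaxMonoidal.associativity (domain M) f g h).trans
        (congrArg (fun x => _ ≫ x ≫ _) (id_tensorHom _ _).symm)))
  left_unitality f := arrow_hom_ext_right (mono_ker _)
    ((Functor.LaxMonoidal.left_unitality (domain M) f).trans
      (congrArg (fun x => x ≫ _) (tensorHom_id _ _).symm))
  right_unitality f := arrow_hom_ext_right (mono_ker _)
    ((Functor.LaxMonoidal.right_unitality (domain M) f).trans
      (congrArg (fun x => x ≫ _) (id_tensorHom _ _).symm))

noncomputable instance : (hoveyKer M).LaxBraided where
  braided f g := arrow_hom_ext_right (mono_ker _)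
    (Functor.LaxBraided.braided (F := domain M) f g)

end HoveyMonoidal

/-! ### Comparison of `O^⊗` with `O^□`, and the adjunction on algebras. -/

section HoveyAlgebra

variable {M : Type u} [Category.{v} M] [MonoidalCategory M] [SymmetricCategory M]
  [HasFiniteColimits M] [∀ W : M, PreservesFiniteColimits (tensorLeft W)] [HasZeroMorphisms M]
  {C : Type w}

open ColoredOperad Functor.LaxMonoidal

/-- The map from the identity arrow of `X` to the cokernel of `⊥ ⟶ X`. -/
noncomputable def idToCoker (X : M) :
    (idArrow M).obj X ⟶ (hoveyCoker M).obj ((initialArrow M).obj X) :=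
  Arrow.homMk (f := Arrow.mk (𝟙 X)) (g := Arrow.mk (cokernel.π (initial.to X)))
    (𝟙 X) (cokernel.π (initial.to X)) rfl

/-- The morphism from `O^⊗` to the image of `O^□` under the cokernel functor. -/
noncomputable def idToCokerHom (O : ColoredOperad C M) :
    OperadHom (O.map (idArrow M)) ((O.map (initialArrow M)).map (hoveyCoker M)) :=
  compareHom idToCoker
    -- Naturality, unit and multiplication are squares out of identity arrows or tensor products of
    -- them, so it is enough to compare domains, where all structure maps are identities.
    (fun {X Y} f => arrow_hom_ext_left (epi_id X)
      ((Category.comp_id f).trans (Category.id_comp f).symm))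
    (arrow_hom_ext_left (epi_id (𝟙_ M)) rfl)
    (fun X Y => arrow_hom_ext_left (epi_tensorHom (epi_id X) (epi_id Y)) (by
      have h : (𝟙 X ⊗ₘ 𝟙 Y) ≫ 𝟙 (X ⊗ Y) ≫ 𝟙 (X ⊗ Y) = 𝟙 (X ⊗ Y) ≫ 𝟙 (X ⊗ Y) := by simp
      exact h)) O

/-- The domain of `Y ⟶ coker f` is `Y` by definition, so `tensLax_compare` applies with identity
maps as `η`; these are then removed from both ends. This equality lets the transported action on
domains collapse to the original one. -/
theorem tensLax_domain_coker {ι : Type w'} (X : ι → PushoutArrow M) (l : List ι) :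
    tensLax (domain M) (fun i => (hoveyCoker M).obj (X i)) l ≫
      (domain M).map (tensLax (hoveyCoker M) X l) = tensLax (codomain M) X l := by
  have h := tensLax_compare (F := codomain M) (L := hoveyCoker M) (E := domain M)
    (fun f => 𝟙 ((codomain M).obj f)) rfl (fun f g => by
      have h : (𝟙 ((codomain M).obj f) ⊗ₘ 𝟙 ((codomain M).obj g)) ≫ 𝟙 _ ≫ 𝟙 _ =
        𝟙 ((codomain M).obj f ⊗ (codomain M).obj g) ≫ 𝟙 _ := by simp
      exact h) X l
  refine Eq.trans ?_ (h.trans (Category.comp_id _))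
  refine ((congrArg (fun x => x ≫ _) (tensMap_id _ l)).trans (Category.id_comp _)).symm

variable [HasKernels M]

/-- The map from `⊥ ⟶ X` to the kernel of the identity arrow of `X`. -/
noncomputable def initialToKer (X : M) :
    (initialArrow M).obj X ⟶ (hoveyKer M).obj ((idArrow M).obj X) :=
  Arrow.homMk (f := Arrow.mk (initial.to X)) (g := Arrow.mk (kernel.ι (𝟙 X)))
    (initial.to _) (𝟙 X) (initialIsInitial.hom_ext _ _)

/-- The morphism from `O^□` to the image of `O^⊗` under the kernel functor. -/
noncomputable def initialToKerHom (O : ColoredOperad C M) :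
    OperadHom (O.map (initialArrow M)) ((O.map (idArrow M)).map (hoveyKer M)) :=
  compareHom initialToKer
    (fun {X Y} f => arrow_hom_ext_right (mono_ker (Arrow.mk (𝟙 Y)))
      ((Category.comp_id f).trans (Category.id_comp f).symm))
    (arrow_hom_ext_right (mono_ker (Arrow.mk (𝟙 (𝟙_ M)))) rfl)
    (fun X Y => arrow_hom_ext_right (mono_ker (Arrow.mk (𝟙 (X ⊗ Y)))) (by
      have h : (𝟙 X ⊗ₘ 𝟙 Y) ≫ 𝟙 (X ⊗ Y) ≫ 𝟙 (X ⊗ Y) = 𝟙 (X ⊗ Y) ≫ 𝟙 (X ⊗ Y) := by simp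
      exact h)) O

/-- The analogue of `tensLax_domain_coker`, resting on the fact that the codomain of `ker g ⟶ A` is
`A` by definition. -/
theorem tensLax_codomain_ker {ι : Type w'} (X : ι → TensorArrow M) (l : List ι) :
    tensLax (codomain M) (fun i => (hoveyKer M).obj (X i)) l ≫
      (codomain M).map (tensLax (hoveyKer M) X l) = tensLax (domain M) X l := by
  have h := tensLax_compare (F := domain M) (L := hoveyKer M) (E := codomain M)
    (fun f => 𝟙 ((domain M).obj f)) rfl (fun f g => by
      have h : (𝟙 ((domain M).obj f) ⊗ₘ 𝟙 ((domain M).obj g)) ≫ 𝟙 _ ≫ 𝟙 _ =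
        𝟙 ((domain M).obj f ⊗ (domain M).obj g) ≫ 𝟙 _ := by simp
      exact h) X l
  refine Eq.trans ?_ (h.trans (Category.comp_id _))
  refine ((congrArg (fun x => x ≫ _) (tensMap_id _ l)).trans (Category.id_comp _)).symm

/-- The cokernel functor from Smith ideals to algebra maps. -/
noncomputable def cokerAlgebra (O : ColoredOperad C M) : SmithIdeal O ⥤ AlgebraMap O :=
  Algebra.transport (hoveyCoker M) (idToCokerHom O)

/-- The kernel functor from algebra maps to Smith ideals. -/
noncomputable def kerAlgebra (O : ColoredOperad C M) : AlgebraMap O ⥤ SmithIdeal O :=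
  Algebra.transport (hoveyKer M) (initialToKerHom O)

/-- The conditions on the unit are equalities of squares into kernel inclusions, and the unit is the
identity on codomains; those on the counit are squares out of epimorphisms, and the counit is the
identity on domains. Each condition thus reduces to a composite of identities in `M`. -/
noncomputable def cokerKerAlgebraAdj (O : ColoredOperad C M) : cokerAlgebra O ⊣ kerAlgebra O :=
  Algebra.transportAdj (hoveyAdj M)
    (arrow_hom_ext_right (mono_ker _) (Category.id_comp _).symm)
    (fun f g => arrow_hom_ext_right (mono_ker _) (by
      have h : (𝟙 (codomain M |>.obj f) ⊗ₘ 𝟙 (codomain M |>.obj g)) ≫ 𝟙 _ ≫ 𝟙 _ = 𝟙 _ := by simp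
      exact h))
    (arrow_hom_ext_left (epi_id (𝟙_ M)) ((Category.id_comp _).trans (Category.id_comp _)))
    (fun f g => arrow_hom_ext_left (epi_tensorHom (epi_coker _) (epi_coker _)) (by
      have h : 𝟙 _ ≫ 𝟙 _ ≫ 𝟙 _ = (𝟙 (domain M |>.obj f) ⊗ₘ 𝟙 (domain M |>.obj g)) := by simp
      exact h))
    (initialToKerHom O) (idToCokerHom O)
    (fun c d => arrow_hom_ext_right (mono_ker _) (Category.id_comp _))
    (fun c d => arrow_hom_ext_left (epi_id (O.entry c d))
      ((Category.id_comp _).trans (Category.id_comp _)))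

theorem cokerAlgebra_domainAlgebra (O : ColoredOperad C M) :
    cokerAlgebra O ⋙ domainAlgebra O = ambientAlgebra O :=
  Algebra.functor_ext (fun A => Algebra.ext_obj_act rfl (heq_of_eq (funext₂ fun c d => by
    -- The left side is the action on domains of the cokernel algebra written out: the identities
    -- are the two operad comparisons and the two multiplications `μ`, while `t` and `s` are the
    -- iterated structure maps of `domain` and coker. Only `t ≫ s` is not trivial, and it equals the
    -- structure map of `codomain`.
    have aux : ∀ {P T U U' D : M} (t : T ⟶ U) (s : U ⟶ U') (r : T ⟶ U') (a : P ⊗ U' ⟶ D),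
        t ≫ s = r → 𝟙 P ▷ T ≫ P ◁ t ≫ 𝟙 (P ⊗ U) ≫ 𝟙 P ▷ U ≫ P ◁ s ≫ 𝟙 (P ⊗ U') ≫ a =
          𝟙 P ▷ T ≫ P ◁ r ≫ 𝟙 (P ⊗ U') ≫ a := by
      rintro P T U U' D t s _ a rfl
      simp
    exact aux _ _ _ ((codomain M).map (A.act c d)) (tensLax_domain_coker A.obj c))))
    (fun _ _ => ((Category.id_comp _).trans (Category.comp_id _)).symm)

theorem kerAlgebra_ambientAlgebra (O : ColoredOperad C M) :
    kerAlgebra O ⋙ ambientAlgebra O = domainAlgebra O :=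
  Algebra.functor_ext (fun A => Algebra.ext_obj_act rfl (heq_of_eq (funext₂ fun c d => by
    -- The same collapse as for coker; here the inner whiskerings appear as tensor products with
    -- identities, which is their form on codomains in the pushout product.
    have aux : ∀ {P T U U' D : M} (t : T ⟶ U) (s : U ⟶ U') (r : T ⟶ U') (a : P ⊗ U' ⟶ D),
        t ≫ s = r → 𝟙 P ▷ T ≫ P ◁ t ≫ 𝟙 (P ⊗ U) ≫ (𝟙 P ⊗ₘ 𝟙 U) ≫ (𝟙 P ⊗ₘ s) ≫ 𝟙 (P ⊗ U') ≫ a =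
          𝟙 P ▷ T ≫ P ◁ r ≫ 𝟙 (P ⊗ U') ≫ a := by
      rintro P T U U' D t s _ a rfl
      simp
    exact aux _ _ _ ((domain M).map (A.act c d)) (tensLax_codomain_ker A.obj c))))
    (fun _ _ => ((Category.id_comp _).trans (Category.comp_id _)).symm)

end HoveyAlgebra

end SmithIdeals

/-! ### The theorem. -/

theorem mainTheorem7 {M : Type u} [Category.{v} M] [MonoidalCategory M] [SymmetricCategory M]
    [HasColimits M] [∀ X : M, PreservesColimits (tensorLeft X)]
    [∀ X : M, PreservesColimits (tensorRight X)]
    [HasZeroObject M] [HasZeroMorphisms M] [HasKernels M]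
    {C : Type w} (O : ColoredOperad C M) :
    ∃ (cok : SmithIdeal O ⥤ AlgebraMap O) (kr : AlgebraMap O ⥤ SmithIdeal O) (adj : cok ⊣ kr)
      (hc : cok ⋙ AlgebraMap.forget O =
        SmithIdeal.forget O ⋙ Functor.pi (fun _ : C => hoveyCoker M))
      (hk : kr ⋙ SmithIdeal.forget O =
        AlgebraMap.forget O ⋙ Functor.pi (fun _ : C => hoveyKer M)),
      cok ⋙ domainAlgebra O = ambientAlgebra O ∧
      kr ⋙ ambientAlgebra O = domainAlgebra O ∧
      (∀ (A : SmithIdeal O) (c : C),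
        (adj.unit.app A).hom c = (hoveyAdj M).unit.app (A.obj c) ≫
          eqToHom ((congrFun (Functor.congr_obj hk (cok.obj A)) c).trans
            (congrArg (hoveyKer M).obj (congrFun (Functor.congr_obj hc A) c))).symm) ∧
      (∀ (B : AlgebraMap O) (c : C),
        (adj.counit.app B).hom c =
          eqToHom ((congrFun (Functor.congr_obj hc (kr.obj B)) c).trans
            (congrArg (hoveyCoker M).obj (congrFun (Functor.congr_obj hk B) c))) ≫
          (hoveyAdj M).counit.app (B.obj c)) :=
  -- The underlying families are those of coker and ker by definition. The `eqToHom` factors in the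
  -- formulas for unit and counit are therefore identities, and only a unit law of composition
  -- remains.
  ⟨cokerAlgebra O, kerAlgebra O, cokerKerAlgebraAdj O, rfl, rfl, cokerAlgebra_domainAlgebra O,
    kerAlgebra_ambientAlgebra O, fun _ _ => (Category.comp_id _).symm,
    fun _ _ => (Category.id_comp _).symm⟩
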